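/- Let $ID(\mathbb R)$ be the set of infinitely divisible probability measures on $\mathbb R$ and $ID(\mathbb R^+)$ the subset of those carried by $[0,\infty)$, both with the topology of weak convergence of probability measures. A measure $\mu\in ID(\mathbb R)$ has characteristic triplet $(\gamma,b,\nu)$ (relative to $\tau(x)=x\mathbf 1_{\{|x|\le 1\}}$) if $\gamma\in\mathbb R$, $b\ge 0$, $\nu(\{0\})=0$, $\int(1\wedge x^2)\,\nu(dx)<\infty$ and $$\log\widehat\mu(z)=iz\gamma-\tfrac12 z^2b+\int_{\mathbb R}\bigl(e^{izx}-1-i\tau(x)z\bigr)\,\nu(dx),\qquad z\in\mathbb R,$$ where $\log\widehat\mu$ is the continuous logarithm of the characteristic function with $\log\widehat\mu(0)=0$. It has triplet $(\beta_0,0,\rho)_0$ if $\rho(\{0\})=0$, $\int(1\wedge|x|)\,\rho(dx)<\infty$ and $\log\widehat\mu(z)=iz\beta_0+\int(e^{izx}-1)\,\rho(dx)$. For $s\ge0$, $\mu^s$ denotes the probability measure with characteristic function $e^{s\log\widehat\mu}$. For $\mu_L\in ID(\mathbb R)$ with triplet $(\gamma,b,\nu)$ and $\mu_T\in ID(\mathbb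 R^+)$ with triplet $(\beta_0,0,\rho)_0$, let $\Lambda(\mu_L,\mu_T)=\overline\mu$ be the infinitely divisible law with characteristic triplet $(\overline\gamma,\overline b,\overline\nu)$ (relative to $\tau$) given by $$\overline b=b\beta_0,\qquad \overline\gamma=\gamma\beta_0+\int_0^\infty\int_{|x|\le1}x\,\mu_L^s(dx)\,\rho(ds),\qquad \overline\nu(A)=\beta_0\,\nu(A)+\int_0^\infty\mu_L^s(A)\,\rho(ds)$$ for Borel sets $A\subset\mathbb R\setminus\{0\}$, and $\overline\nu(\{0\})=0$. Then $\Lambda:ID(\mathbb R)\times ID(\mathbb R^+)\to ID(\mathbb R)$ is well defined, and both of its sections are continuous with respect to weak convergence: for every fixed $\mu_L\in ID(\mathbb R)$ the map $\Lambda_{\mu_L}:ID(\mathbb R^+)\to ID(\mathbb R)$, $\mu_T\mapsto\Lambda(\mu_L,\mu_T)$, is continuous, and for every fixed $\mu_T\in ID(\mathbb R^+)$ the map $\Lambda_{\mu_T}:ID(\mathbb R)\to ID(\mathbb R)$, $\mu_L\mapsto\Lambda(\mu_L,\mu_T)$, is continuous. -/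

import Mathlib

open MeasureTheory
open scoped ENNReal

noncomputable section

namespace LevySubordination

/-- The `n`-fold convolution of a measure on `ℝ` with itself (`δ₀` for `n = 0`). -/
def convPow (η : Measure ℝ) : ℕ → Measure ℝ
  | 0 => Measure.dirac 0
  | n + 1 => Measure.conv (convPow η n) η

/-- `ID(ℝ)`: the infinitely divisible probability measures on `ℝ`, that is, those which have
a convolution root of every order. -/
def ID : Set (ProbabilityMeasure ℝ) :=
  {μ | ∀ n : ℕ, 0 < n → ∃ η : ProbabilityMeasure ℝ,
    convPow (η : Measure ℝ) n = (μ : Measure ℝ)}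

/-- `ID(ℝ⁺)`: the infinitely divisible probability measures carried by `[0, ∞)`. -/
def IDPos : Set (ProbabilityMeasure ℝ) :=
  {μ | μ ∈ ID ∧ (μ : Measure ℝ) (Set.Iio 0) = 0}

/-- Lévy measures on `ℝ`: no mass at `0` and `∫ (1 ∧ x²) ν(dx) < ∞`. -/
def IsLevyMeasure (ν : Measure ℝ) : Prop :=
  ν {0} = 0 ∧ ∫⁻ x, ENNReal.ofReal (min 1 (x ^ 2)) ∂ν < ∞

/-- The truncation function `τ(x) = x 1_{|x| ≤ 1}`. -/
def tau (x : ℝ) : ℝ := if |x| ≤ 1 then x else 0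

/-- The truncation function `τ₀ = 0`. -/
def tauZero (_ : ℝ) : ℝ := 0

/-- The Lévy-Khintchine exponent with triplet `(γ, b, ν)` relative to the truncation
function `t`:  `i z γ - z² b / 2 + ∫ (e^{izx} - 1 - i t(x) z) ν(dx)`. -/
def levyExponent (t : ℝ → ℝ) (γ b : ℝ) (ν : Measure ℝ) (z : ℝ) : ℂ :=
  Complex.I * z * γ - (z : ℂ) ^ 2 * b / 2
    + ∫ x, (Complex.exp (Complex.I * z * x) - 1 - Complex.I * (t x) * z) ∂ν

/-- `μ` has characteristic triplet `(γ, b, ν)` relative to `τ`. -/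
def HasTriplet (μ : ProbabilityMeasure ℝ) (γ b : ℝ) (ν : Measure ℝ) : Prop :=
  0 ≤ b ∧ IsLevyMeasure ν ∧
    ∀ z : ℝ, charFun (μ : Measure ℝ) z = Complex.exp (levyExponent tau γ b ν z)

/-- `μ` has characteristic triplet `(β₀, 0, ρ)₀` relative to `τ₀ = 0`; here the Lévy measure
`ρ` satisfies `∫ (1 ∧ |x|) ρ(dx) < ∞`. -/
def HasPair (μ : ProbabilityMeasure ℝ) (β₀ : ℝ) (ρ : Measure ℝ) : Prop :=
  IsLevyMeasure ρ ∧ ∫⁻ x, ENNReal.ofReal (min 1 |x|) ∂ρ < ∞ ∧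
    ∀ z : ℝ, charFun (μ : Measure ℝ) z = Complex.exp (levyExponent tauZero β₀ 0 ρ z)

/-- `φ` is the characteristic exponent of `μ`: the continuous function with `φ(0) = 0` and
`e^φ` equal to the characteristic function of `μ` (the distinguished logarithm). -/
def IsCharExponent (μ : ProbabilityMeasure ℝ) (φ : ℝ → ℂ) : Prop :=
  Continuous φ ∧ φ 0 = 0 ∧ ∀ z : ℝ, charFun (μ : Measure ℝ) z = Complex.exp (φ z)

/-- The convolution power `μ^s`, `s ≥ 0`, of an infinitely divisible law `μ`: the probability
measure with characteristic function `e^{s φ}`, with `φ` the characteristic exponent of `μ`. -/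
def convRPow (μ : ProbabilityMeasure ℝ) (s : ℝ) : ProbabilityMeasure ℝ :=
  Classical.epsilon fun η : ProbabilityMeasure ℝ =>
    ∃ φ : ℝ → ℂ, IsCharExponent μ φ ∧
      ∀ z : ℝ, charFun (η : Measure ℝ) z = Complex.exp ((s : ℂ) * φ z)

/-- The mixture `Φ_μ(ρ)(A) = ∫_0^∞ μ^s(A) ρ(ds)` for `A ⊆ ℝ ∖ {0}`, without mass at `0`. -/
def levyMix (μ : ProbabilityMeasure ℝ) (ρ : Measure ℝ) : Measure ℝ :=
  ((ρ.restrict (Set.Ioi 0)).bind fun s => (convRPow μ s : Measure ℝ)).restrict {0}ᶜ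

/-- `m_μ(s) = ∫_{|x| ≤ 1} x μ^s(dx)`. -/
def truncMean (μ : ProbabilityMeasure ℝ) (s : ℝ) : ℝ :=
  ∫ x in {x : ℝ | |x| ≤ 1}, x ∂(convRPow μ s : Measure ℝ)

/-- The graph of `Λ`: `μ_L` has triplet `(γ, b, ν)`, `μ_T` has triplet `(β₀, 0, ρ)₀`, and `μbar`
has the triplet
`(γ β₀ + ∫_0^∞ ∫_{|x| ≤ 1} x μ_L^s(dx) ρ(ds), b β₀, β₀ ν + ∫_0^∞ μ_L^s ρ(ds))`. -/
def IsLambda (μL μT μbar : ProbabilityMeasure ℝ) : Prop :=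
  ∃ (γ b : ℝ) (ν : Measure ℝ) (β₀ : ℝ) (ρ : Measure ℝ),
    HasTriplet μL γ b ν ∧ HasPair μT β₀ ρ ∧ 0 ≤ β₀ ∧
    IntegrableOn (truncMean μL) (Set.Ioi 0) ρ ∧
    HasTriplet μbar (γ * β₀ + ∫ s in Set.Ioi 0, truncMean μL s ∂ρ) (b * β₀)
      (ENNReal.ofReal β₀ • ν + levyMix μL ρ)

/-- `Λ(μ_L, μ_T)`: the law `μbar` with the triplet prescribed by `IsLambda`. -/
def Lambda (μL μT : ProbabilityMeasure ℝ) : ProbabilityMeasure ℝ :=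
  Classical.epsilon (IsLambda μL μT)

/-- The section `Λ_{μ_L}`, with domain `ID(ℝ⁺)`. -/
def LambdaL (μL : ProbabilityMeasure ℝ) (μT : IDPos) : ProbabilityMeasure ℝ :=
  Lambda μL (μT : ProbabilityMeasure ℝ)

/-- The section `Λ_{μ_T}`, with domain `ID(ℝ)`. -/
def LambdaT (μT : ProbabilityMeasure ℝ) (μL : ID) : ProbabilityMeasure ℝ :=
  Lambda (μL : ProbabilityMeasure ℝ) μT

end LevySubordination

end

namespace LevySubordination

open Filter Topology ProbabilityTheory

/-! ### Elementary inequalities for `1 - sinc`, the truncation and the exponential -/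

section Estimates

/-! The law prescribed by the triplet formula is the law of a Lévy process run at an independent
random time, namely the mixture `∫ μ_L^s μ_T(ds)` (`subordinated`). If `φ` is the exponent of `μ_L`,
Fubini gives its characteristic function as the Laplace transform of `μ_T` at `φ z`, a point of the
closed left half-plane (`charFun_subordinated`). That transform is `exp(β₀ w + ∫ (e^{sw} - 1)
ρ(ds))`, and at `w = φ z` the exponent is exactly the Lévy-Khintchine exponent of the prescribed
triplet (`levyExponent_subordinated`).

Well-definedness needs a triplet for `μ_L` (`exists_hasTriplet`), and for `μ_T` a pair with its
Laplace exponent on the half-plane (`exists_hasPair`). Both come from compactness: if `η_n` is an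
`n`-th convolution root, the measures `n · weight · η_n` are tight with bounded mass, and a limit of
them along an ultrafilter carries the Lévy measure, together with the Gaussian part or the drift. A
pair only describes `μ_T` on the imaginary axis; `HasPair.unique` lets any pair inherit the
half-plane formula. Uniqueness of the triplet of `μ_L` is not needed, since the result depends on it
only through `φ`.

Once `Λ` is identified with subordination, continuity in `μ_T` holds because `s ↦ ∫ f dμ_L^s` is
bounded and continuous for each bounded continuous `f`. For continuity in `μ_L`, weak convergence
forces pointwise convergence of exponents (`tendsto_charExponent`), and dominated convergence under
`μ_T` finishes. -/

theorem abs_one_sub_sinc_sub_le {x : ℝ} (hx : |x| ≤ 1) :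
    |1 - Real.sinc x - x ^ 2 / 6| ≤ x ^ 4 / 100 := by
  rcases eq_or_ne x 0 with rfl | h0
  · simp
  have h := Real.sin_bound hx
  have hpos : 0 < |x| := abs_pos.mpr h0
  have e : Real.sin x - (x - x ^ 3 / 6) = -(x * (1 - Real.sinc x - x ^ 2 / 6)) := by
    rw [Real.sinc_of_ne_zero h0]; field_simp; ring
  rw [e, abs_neg, abs_mul] at h
  have e2 : |x| ^ 5 / 100 = |x| * (x ^ 4 / 100) := by
    rw [← Even.pow_abs (by decide : Even 4) x]; ring
  rw [e2] at h
  exact le_of_mul_le_mul_left h hpos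

theorem sq_le_one_sub_sinc {x : ℝ} (hx : |x| ≤ 1) : x ^ 2 / 10 ≤ 1 - Real.sinc x := by
  have h := (abs_le.mp (abs_one_sub_sinc_sub_le hx)).1
  have h2 : x ^ 2 ≤ 1 := (sq_le_one_iff_abs_le_one x).mpr hx
  nlinarith [sq_nonneg x]

theorem one_sub_sinc_nonneg (x : ℝ) : 0 ≤ 1 - Real.sinc x := sub_nonneg.mpr (Real.sinc_le_one x)

/-- Up to `|x| = 2` the half-angle identity `sinc x = sinc (x/2) cos (x/2)` reduces to the bound on
`[-1, 1]`; beyond that `sinc x ≤ 1/|x|` suffices. -/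
theorem one_sub_sinc_ge_of_one_le_abs {x : ℝ} (hx : 1 ≤ |x|) : 1 / 40 ≤ 1 - Real.sinc x := by
  have h0 : x ≠ 0 := by rintro rfl; norm_num at hx
  rcases le_or_gt |x| 2 with h | h
  · have hx2 : |x / 2| ≤ 1 := by rw [abs_div]; norm_num; linarith
    have h1 := sq_le_one_sub_sinc hx2
    have e : Real.sinc x = Real.sinc (x / 2) * Real.cos (x / 2) := by
      rw [Real.sinc_of_ne_zero h0, Real.sinc_of_ne_zero (by positivity)]
      have : Real.sin x = 2 * Real.sin (x / 2) * Real.cos (x / 2) := by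
        rw [← Real.sin_two_mul]; congr 1; ring
      rw [this]; field_simp
    have hs : 0 ≤ Real.sinc (x / 2) := by
      have := (abs_le.mp (abs_one_sub_sinc_sub_le hx2)).2
      have h2 : (x / 2) ^ 2 ≤ 1 := (sq_le_one_iff_abs_le_one _).mpr hx2
      nlinarith [sq_nonneg (x / 2)]
    have hle : Real.sinc x ≤ Real.sinc (x / 2) := by
      rw [e]; exact mul_le_of_le_one_right hs (Real.cos_le_one _)
    have h3 : 1 ≤ x ^ 2 := (one_le_sq_iff_one_le_abs x).mpr hx
    nlinarith
  · have h1 := Real.sinc_le_inv_abs h0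
    have h2 : |x|⁻¹ ≤ 2⁻¹ := by gcongr
    norm_num at h2 ⊢
    linarith

/-- With `one_sub_sinc_le`, this makes `1 - sinc` a continuous substitute for `1 ∧ x²`. It is the
natural weight because averaging `1 - charFun` over `[-1, 1]` produces it. -/
theorem min_one_sq_le (x : ℝ) : min 1 (x ^ 2) ≤ 40 * (1 - Real.sinc x) := by
  rcases le_or_gt |x| 1 with h | h
  · have := sq_le_one_sub_sinc h
    have := min_le_right 1 (x ^ 2)
    nlinarith [sq_nonneg x]
  · have := one_sub_sinc_ge_of_one_le_abs h.le
    have := min_le_left 1 (x ^ 2)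
    linarith

theorem one_sub_sinc_le (x : ℝ) : 1 - Real.sinc x ≤ 2 * min 1 (x ^ 2) := by
  rcases le_or_gt |x| 1 with h | h
  · have h1 := (abs_le.mp (abs_one_sub_sinc_sub_le h)).2
    have h2 : x ^ 2 ≤ 1 := (sq_le_one_iff_abs_le_one x).mpr h
    rw [min_eq_right h2]
    nlinarith [sq_nonneg x]
  · have h3 : 1 ≤ x ^ 2 := (one_le_sq_iff_one_le_abs x).mpr h.le
    rw [min_eq_left h3]
    linarith [Real.neg_one_le_sinc x]

theorem one_sub_sinc_pos {x : ℝ} (hx : x ≠ 0) : 0 < 1 - Real.sinc x := by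
  have := min_one_sq_le x
  have : 0 < min 1 (x ^ 2) := by positivity
  linarith

/-- Limits are taken with the continuous truncation `sin`; this bound makes the change back to `τ`
an integrable correction. -/
theorem abs_tau_sub_sin_le (x : ℝ) : |tau x - Real.sin x| ≤ 40 * (1 - Real.sinc x) := by
  unfold tau
  have h0 := one_sub_sinc_nonneg x
  split_ifs with h
  · have e : x - Real.sin x = x * (1 - Real.sinc x) := by
      rcases eq_or_ne x 0 with rfl | h0
      · simp
      · rw [Real.sinc_of_ne_zero h0]; field_simp
    rw [e, abs_mul, abs_of_nonneg h0]
    nlinarith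
  · have := one_sub_sinc_ge_of_one_le_abs (not_le.mp h).le
    rw [zero_sub, abs_neg]
    linarith [Real.abs_sin_le_one x]

theorem measurable_tau : Measurable tau :=
  Measurable.ite (measurableSet_le (by fun_prop) (by fun_prop)) measurable_id measurable_const

theorem abs_tau_le (x : ℝ) : |tau x| ≤ 1 := by
  unfold tau; split_ifs with h <;> simp [h]

theorem norm_exp_I_mul (u : ℝ) : ‖Complex.exp (Complex.I * u)‖ = 1 := by
  rw [mul_comm]; exact Complex.norm_exp_ofReal_mul_I u

theorem norm_exp_I_sub_one_sub_le (u : ℝ) :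
    ‖Complex.exp (Complex.I * u) - 1 - Complex.I * u‖ ≤ 3 * u ^ 2 := by
  have hn : ‖Complex.I * (u : ℂ)‖ = |u| := by simp
  rcases le_or_gt |u| 1 with h | h
  · have := Complex.norm_exp_sub_one_sub_id_le (x := Complex.I * u) (by rw [hn]; exact h)
    rw [hn, sq_abs] at this
    nlinarith [sq_nonneg u]
  · have h1 : ‖Complex.exp (Complex.I * u) - 1 - Complex.I * u‖ ≤ 1 + 1 + |u| := by
      refine (norm_sub_le _ _).trans ?_
      rw [hn]
      gcongr
      refine (norm_sub_le _ _).trans ?_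
      rw [norm_exp_I_mul]; simp
    nlinarith [sq_abs u]

theorem norm_levyIntegrand_tau_le (z x : ℝ) :
    ‖Complex.exp (Complex.I * z * x) - 1 - Complex.I * (tau x) * z‖
      ≤ 3 * (z ^ 2 + 1) * min 1 (x ^ 2) := by
  unfold tau
  split_ifs with h
  · have := norm_exp_I_sub_one_sub_le (z * x)
    push_cast at this
    rw [show Complex.I * (z : ℂ) * x = Complex.I * (z * x) by ring,
      show Complex.I * (x : ℂ) * z = Complex.I * (z * x) by ring]
    rw [min_eq_right ((sq_le_one_iff_abs_le_one x).mpr h)]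
    nlinarith [sq_nonneg x]
  · rw [min_eq_left ((one_le_sq_iff_one_le_abs x).mpr (not_le.mp h).le)]
    have : ‖Complex.exp (Complex.I * z * x) - 1‖ ≤ 1 + 1 := by
      refine (norm_sub_le _ _).trans ?_
      have := norm_exp_I_mul (z * x)
      push_cast at this
      rw [mul_assoc, this]; simp
    simp only [Complex.ofReal_zero, mul_zero, zero_mul, sub_zero]
    nlinarith [sq_nonneg z]

theorem norm_levyIntegrand_tauZero_le (z x : ℝ) :
    ‖Complex.exp (Complex.I * z * x) - 1 - Complex.I * (tauZero x) * z‖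
      ≤ (|z| + 2) * min 1 |x| := by
  simp only [tauZero, Complex.ofReal_zero, mul_zero, zero_mul, sub_zero]
  rcases le_total |x| 1 with h | h
  · rw [min_eq_right h]
    have := Real.norm_exp_I_mul_ofReal_sub_one_le (x := z * x)
    push_cast at this
    rw [mul_assoc]
    refine this.trans ?_
    rw [norm_mul, Real.norm_eq_abs, Real.norm_eq_abs]
    nlinarith [abs_nonneg x]
  · rw [min_eq_left h]
    refine (norm_sub_le _ _).trans ?_
    have := norm_exp_I_mul (z * x)
    push_cast at this
    rw [mul_assoc, this]
    simp; linarith [abs_nonneg z]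

/-- Mean value inequality on the convex left half-plane, where the derivative of `exp` has norm at
most 1. -/
theorem norm_exp_sub_one_le_of_re_nonpos {w : ℂ} (hw : w.re ≤ 0) :
    ‖Complex.exp w - 1‖ ≤ ‖w‖ := by
  have hconv : Convex ℝ {z : ℂ | z.re ≤ 0} := convex_halfSpace_re_le 0
  have := hconv.norm_image_sub_le_of_norm_hasDerivWithin_le (f := Complex.exp) (f' := Complex.exp)
    (C := 1) (x := 0) (y := w) (fun z _ => (Complex.hasDerivAt_exp z).hasDerivWithinAt)
    (fun z hz => by rw [Complex.norm_exp]; exact Real.exp_le_one_iff.mpr hz) (by simp) hw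
  simpa using this

theorem norm_exp_mul_sub_one_le {w : ℂ} (hw : w.re ≤ 0) {s : ℝ} (hs : 0 ≤ s) :
    ‖Complex.exp (s * w) - 1‖ ≤ (‖w‖ + 2) * min 1 s := by
  have hre : ((s : ℂ) * w).re ≤ 0 := by
    rw [Complex.re_ofReal_mul]; exact mul_nonpos_of_nonneg_of_nonpos hs hw
  rcases le_total s 1 with h | h
  · rw [min_eq_right h]
    refine (norm_exp_sub_one_le_of_re_nonpos hre).trans ?_
    rw [norm_mul, Complex.norm_real, Real.norm_of_nonneg hs]
    nlinarith [norm_nonneg w]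
  · rw [min_eq_left h]
    refine (norm_sub_le _ _).trans ?_
    have : ‖Complex.exp (s * w)‖ ≤ 1 := by
      rw [Complex.norm_exp]; exact Real.exp_le_one_iff.mpr hre
    simp only [norm_one]; linarith [norm_nonneg w]

end Estimates

/-! ### Bounded continuous kernels for the two compactness arguments -/

section Kernels

/-- The compensated kernel `(e^{izx} - 1 - i z sin x) / (1 - sin x / x)`, extended continuously
to `x = 0`. -/
noncomputable def levyKernel (z : ℝ) : ℝ → ℂ :=
  Function.update (fun x : ℝ =>
    (Complex.exp (Complex.I * z * x) - 1 - Complex.I * (Real.sin x) * z)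
      / ((1 - Real.sinc x : ℝ) : ℂ)) 0 (-3 * (z : ℂ) ^ 2)

theorem levyKernel_zero (z : ℝ) : levyKernel z 0 = -3 * (z : ℂ) ^ 2 := by simp [levyKernel]

theorem levyKernel_mul (z x : ℝ) : ((1 - Real.sinc x : ℝ) : ℂ) * levyKernel z x
    = Complex.exp (Complex.I * z * x) - 1 - Complex.I * (Real.sin x) * z := by
  rcases eq_or_ne x 0 with rfl | h
  · simp
  · have h1 : ((1 - Real.sinc x : ℝ) : ℂ) ≠ 0 := by exact_mod_cast (one_sub_sinc_pos h).ne'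
    rw [levyKernel, Function.update_of_ne h]
    field_simp

theorem tendsto_one_sub_sinc_div_sq :
    Tendsto (fun x : ℝ => (1 - Real.sinc x) / x ^ 2) (𝓝[≠] 0) (𝓝 (1 / 6)) := by
  rw [tendsto_iff_norm_sub_tendsto_zero]
  have hlim : Tendsto (fun x : ℝ => x ^ 2 / 100) (𝓝[≠] 0) (𝓝 0) := by
    have : Tendsto (fun x : ℝ => x ^ 2 / 100) (𝓝 0) (𝓝 (0 ^ 2 / 100)) :=
      (Continuous.tendsto (by fun_prop) 0)
    simp only [ne_eq, OfNat.ofNat_ne_zero, not_false_eq_true, zero_pow, zero_div] at this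
    exact this.mono_left nhdsWithin_le_nhds
  refine squeeze_zero' (Eventually.of_forall fun _ => norm_nonneg _) ?_ hlim
  have h1 : ∀ᶠ x : ℝ in 𝓝[≠] 0, |x| ≤ 1 := by
    refine Filter.Eventually.filter_mono nhdsWithin_le_nhds ?_
    filter_upwards [Metric.ball_mem_nhds (0 : ℝ) one_pos] with x hx
    simpa using (mem_ball_zero_iff.mp hx).le
  filter_upwards [h1, self_mem_nhdsWithin] with x hx hx0
  have hx0 : x ≠ 0 := hx0
  have e : (1 - Real.sinc x) / x ^ 2 - 1 / 6 = (1 - Real.sinc x - x ^ 2 / 6) / x ^ 2 := by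
    field_simp
  rw [e, Real.norm_eq_abs, abs_div, abs_of_nonneg (sq_nonneg x), div_le_iff₀ (by positivity)]
  refine (abs_one_sub_sinc_sub_le hx).trans (le_of_eq (by ring))

theorem tendsto_exp_sub_div_sq (z : ℝ) :
    Tendsto (fun x : ℝ => (Complex.exp (Complex.I * z * x) - 1 - Complex.I * z * x) / (x : ℂ) ^ 2)
      (𝓝[≠] 0) (𝓝 (-(z : ℂ) ^ 2 / 2)) := by
  rw [tendsto_iff_norm_sub_tendsto_zero]
  have hlim : Tendsto (fun x : ℝ => |z| ^ 3 * |x|) (𝓝[≠] 0) (𝓝 0) := by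
    have : Tendsto (fun x : ℝ => |z| ^ 3 * |x|) (𝓝 0) (𝓝 (|z| ^ 3 * |0|)) :=
      (Continuous.tendsto (by fun_prop) 0)
    rw [abs_zero, mul_zero] at this
    exact this.mono_left nhdsWithin_le_nhds
  refine squeeze_zero' (Eventually.of_forall fun _ => norm_nonneg _) ?_ hlim
  have h1 : ∀ᶠ x : ℝ in 𝓝[≠] 0, |z * x| ≤ 1 := by
    refine Filter.Eventually.filter_mono nhdsWithin_le_nhds ?_
    have : Tendsto (fun x : ℝ => |z * x|) (𝓝 0) (𝓝 |z * 0|) :=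
      (Continuous.tendsto (by fun_prop) 0)
    rw [mul_zero, abs_zero] at this
    exact (this.eventually (gt_mem_nhds one_pos)).mono fun x hx => hx.le
  filter_upwards [h1, self_mem_nhdsWithin] with x hx hx0
  have hx0 : x ≠ 0 := hx0
  have hx0' : (x : ℂ) ≠ 0 := by exact_mod_cast hx0
  have hn : ‖Complex.I * (z : ℂ) * x‖ = |z| * |x| := by simp
  have hb := Complex.exp_bound (x := Complex.I * z * x) (by rw [hn, ← abs_mul]; exact hx)
    (n := 3) (by norm_num)
  simp only [Finset.sum_range_succ, Finset.sum_range_zero, hn] at hb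
  have e : (Complex.exp (Complex.I * z * x) - 1 - Complex.I * z * x) / (x : ℂ) ^ 2
      - (-(z : ℂ) ^ 2 / 2) = (Complex.exp (Complex.I * z * x) - (0 + (Complex.I * z * x) ^ 0 /
        (Nat.factorial 0 : ℂ) + (Complex.I * z * x) ^ 1 / (Nat.factorial 1 : ℂ)
        + (Complex.I * z * x) ^ 2 / (Nat.factorial 2 : ℂ))) / (x : ℂ) ^ 2 := by
    simp only [Nat.factorial, mul_pow, Complex.I_sq]
    push_cast
    field_simp
    ring
  rw [e, norm_div, norm_pow, Complex.norm_real, Real.norm_eq_abs, div_le_iff₀ (by positivity)]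
  refine hb.trans ?_
  norm_num [Nat.factorial]
  have h0 : 0 ≤ (|z| * |x|) ^ 3 := by positivity
  have h2 : |z| ^ 3 * |x| * x ^ 2 = (|z| * |x|) ^ 3 := by rw [← sq_abs x]; ring
  rw [h2]
  linarith

/-- Since `x - sin x = x (1 - sinc x)`, away from 0 the kernel equals `(e^{izx} - 1 - izx) / (1 -
sinc x) + izx`. Dividing top and bottom by `x²` gives the limit `(-z²/2) / (1/6) = -3z²`. -/
theorem continuous_levyKernel (z : ℝ) : Continuous (levyKernel z) := by
  rw [continuous_iff_continuousAt]
  intro x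
  rcases eq_or_ne x 0 with rfl | h
  · refine continuousAt_update_same.mpr ?_
    have h1 := tendsto_exp_sub_div_sq z
    have h2 : Tendsto (fun x : ℝ => (((1 - Real.sinc x) / x ^ 2 : ℝ) : ℂ)) (𝓝[≠] 0)
        (𝓝 ((1 / 6 : ℝ) : ℂ)) :=
      (Complex.continuous_ofReal.tendsto _).comp tendsto_one_sub_sinc_div_sq
    have h3 : Tendsto (fun x : ℝ => Complex.I * z * (x : ℂ)) (𝓝[≠] 0) (𝓝 0) := by
      have : Tendsto (fun x : ℝ => Complex.I * z * (x : ℂ)) (𝓝 0)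
        (𝓝 (Complex.I * z * ((0 : ℝ) : ℂ))) := (Continuous.tendsto (by fun_prop) 0)
      rw [Complex.ofReal_zero, mul_zero] at this
      exact this.mono_left nhdsWithin_le_nhds
    have h4 := (h1.div h2 (by norm_num)).add h3
    have e : -(z : ℂ) ^ 2 / 2 / ((1 / 6 : ℝ) : ℂ) + 0 = -3 * (z : ℂ) ^ 2 := by push_cast; ring
    rw [e] at h4
    refine h4.congr' ?_
    filter_upwards [self_mem_nhdsWithin] with x hx0
    have hx0 : x ≠ 0 := hx0
    have hx0' : (x : ℂ) ≠ 0 := by exact_mod_cast hx0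
    have hd : ((1 - Real.sinc x : ℝ) : ℂ) ≠ 0 := by exact_mod_cast (one_sub_sinc_pos hx0).ne'
    have es : ((Real.sin x : ℝ) : ℂ) = x - x * ((1 - Real.sinc x : ℝ) : ℂ) := by
      rw [Real.sinc_of_ne_zero hx0]; push_cast; field_simp; ring
    rw [es]
    simp only [Pi.div_apply, Complex.ofReal_div, Complex.ofReal_pow]
    field_simp
    ring
  · refine (continuousAt_update_of_ne h).mpr ?_
    have hd : ((1 - Real.sinc x : ℝ) : ℂ) ≠ 0 := by exact_mod_cast (one_sub_sinc_pos h).ne'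
    refine ContinuousAt.div ?_ ?_ hd
    · fun_prop
    · refine (Complex.continuous_ofReal.comp ?_).continuousAt
      exact continuous_const.sub Real.continuous_sinc

theorem exists_norm_levyKernel_le (z : ℝ) : ∃ C, ∀ x, ‖levyKernel z x‖ ≤ C := by
  obtain ⟨C, hC⟩ := (isCompact_Icc (a := (-1 : ℝ)) (b := 1)).exists_bound_of_continuousOn
    (continuous_levyKernel z).continuousOn
  refine ⟨max C (40 * (2 + |z|)), fun x => ?_⟩
  rcases le_or_gt |x| 1 with h | h
  · exact (hC x (abs_le.mp h)).trans (le_max_left _ _)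
  · refine le_trans ?_ (le_max_right _ _)
    have h1 := one_sub_sinc_ge_of_one_le_abs h.le
    have h2 := congrArg norm (levyKernel_mul z x)
    rw [norm_mul, Complex.norm_real, Real.norm_of_nonneg (one_sub_sinc_nonneg x)] at h2
    have h3 : ‖Complex.exp (Complex.I * z * x) - 1 - Complex.I * (Real.sin x) * z‖ ≤ 2 + |z| := by
      refine (norm_sub_le _ _).trans ?_
      refine add_le_add ((norm_sub_le _ _).trans ?_) ?_
      · have := norm_exp_I_mul (z * x)
        push_cast at this
        rw [mul_assoc, this]; norm_num
      · rw [norm_mul, norm_mul, Complex.norm_I, Complex.norm_real, Complex.norm_real, one_mul]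
        exact mul_le_of_le_one_left (norm_nonneg _) (Real.abs_sin_le_one x)
    nlinarith [norm_nonneg (levyKernel z x)]

/-- The kernel `(e^{xw} - 1) / (1 - e^{-x})` for `x > 0`, extended by its limit `w` to `x ≤ 0`. -/
noncomputable def laplaceKernel (w : ℂ) (x : ℝ) : ℂ :=
  Function.update (fun x : ℝ => (Complex.exp (x * w) - 1) / ((1 - Real.exp (-x) : ℝ) : ℂ)) 0 w
    (max x 0)

theorem laplaceKernel_of_nonpos (w : ℂ) {x : ℝ} (hx : x ≤ 0) : laplaceKernel w x = w := by
  simp [laplaceKernel, hx]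

theorem laplaceKernel_of_pos (w : ℂ) {x : ℝ} (hx : 0 < x) :
    laplaceKernel w x = (Complex.exp (x * w) - 1) / ((1 - Real.exp (-x) : ℝ) : ℂ) := by
  rw [laplaceKernel, max_eq_left hx.le, Function.update_of_ne hx.ne']

theorem one_sub_exp_neg_pos {x : ℝ} (hx : 0 < x) : 0 < 1 - Real.exp (-x) := by
  rw [sub_pos, Real.exp_lt_one_iff]; linarith

theorem laplaceKernel_mul (w : ℂ) (x : ℝ) :
    ((1 - Real.exp (-max x 0) : ℝ) : ℂ) * laplaceKernel w x
      = Complex.exp ((max x 0 : ℝ) * w) - 1 := by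
  rcases le_or_gt x 0 with h | h
  · simp [h]
  · have hd : ((1 - Real.exp (-x) : ℝ) : ℂ) ≠ 0 := by exact_mod_cast (one_sub_exp_neg_pos h).ne'
    rw [laplaceKernel_of_pos w h, max_eq_left h.le]
    field_simp

/-- At 0 the kernel is minus the quotient of the slopes of `e^{xw}` and `e^{-x}`, whose limits are
`w` and `-1`. -/
theorem continuous_laplaceKernel (w : ℂ) : Continuous (laplaceKernel w) := by
  refine Continuous.comp (g := Function.update
    (fun x : ℝ => (Complex.exp (x * w) - 1) / ((1 - Real.exp (-x) : ℝ) : ℂ)) 0 w)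
    ?_ (continuous_id.max continuous_const)
  rw [continuous_iff_continuousAt]
  intro x
  rcases eq_or_ne x 0 with rfl | h
  · refine continuousAt_update_same.mpr ?_
    have d1 : HasDerivAt (fun x : ℝ => Complex.exp (x * w)) w 0 := by
      have h1 : HasDerivAt (fun x : ℝ => (x : ℂ) * w) (1 * w) 0 :=
        (Complex.ofRealCLM.hasDerivAt (x := (0 : ℝ))).mul_const w
      have := h1.cexp
      simpa using this
    have d2 : HasDerivAt (fun x : ℝ => Real.exp (-x)) (-1) 0 := by
      have := (hasDerivAt_neg (0 : ℝ)).exp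
      simpa using this
    have h1 := hasDerivAt_iff_tendsto_slope.mp d1
    have h2 := (Complex.continuous_ofReal.tendsto _).comp (hasDerivAt_iff_tendsto_slope.mp d2)
    have h3 := (h1.div h2 (by norm_num)).neg
    have e : -(w / ((-1 : ℝ) : ℂ)) = w := by push_cast; ring
    rw [e] at h3
    refine h3.congr' ?_
    filter_upwards [self_mem_nhdsWithin] with x hx0
    have hx0' : (x : ℂ) ≠ 0 := by exact_mod_cast hx0
    simp only [Pi.div_apply, Function.comp, slope_def_module, sub_zero, Complex.ofReal_zero,
      zero_mul, Complex.exp_zero, neg_zero, Real.exp_zero, smul_eq_mul, Complex.ofReal_mul,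
      Complex.real_smul, Complex.ofReal_inv, Complex.ofReal_sub, Complex.ofReal_one]
    rw [mul_div_mul_left _ _ (inv_ne_zero hx0'), ← div_neg, neg_sub]
  · refine (continuousAt_update_of_ne h).mpr ?_
    have hd : ((1 - Real.exp (-x) : ℝ) : ℂ) ≠ 0 := by
      have : Real.exp (-x) ≠ 1 := by rw [Ne, Real.exp_eq_one_iff]; simpa using h
      exact_mod_cast sub_ne_zero.mpr this.symm
    exact ContinuousAt.div (by fun_prop) (by fun_prop) hd

theorem min_one_le_one_sub_exp_neg {x : ℝ} (hx : 0 ≤ x) : min 1 x ≤ 2 * (1 - Real.exp (-x)) := by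
  rcases le_total x 1 with h | h
  · rw [min_eq_right h]
    have h1 := Real.one_sub_le_exp_neg x
    have h2 : (1 + x) * Real.exp (-x) ≤ 1 := by
      have := Real.add_one_le_exp x
      calc (1 + x) * Real.exp (-x) ≤ Real.exp x * Real.exp (-x) := by gcongr; linarith
        _ = 1 := by rw [← Real.exp_add]; simp
    nlinarith
  · rw [min_eq_left h]
    have h1 : Real.exp (-x) ≤ Real.exp (-1) := by gcongr
    have h2 : 2 * Real.exp (-1) ≤ 1 := by
      have := Real.add_one_le_exp (1 : ℝ)
      calc 2 * Real.exp (-1) ≤ Real.exp 1 * Real.exp (-1) := by gcongr; linarith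
        _ = 1 := by rw [← Real.exp_add]; simp
    linarith

theorem norm_laplaceKernel_le {w : ℂ} (hw : w.re ≤ 0) (x : ℝ) :
    ‖laplaceKernel w x‖ ≤ 2 * (‖w‖ + 2) := by
  rcases le_or_gt x 0 with h | h
  · rw [laplaceKernel_of_nonpos w h]; linarith [norm_nonneg w]
  · have hp := one_sub_exp_neg_pos h
    rw [laplaceKernel_of_pos w h, norm_div, Complex.norm_real, Real.norm_of_nonneg hp.le,
      div_le_iff₀ hp]
    have h1 := norm_exp_mul_sub_one_le hw h.le
    have h2 := min_one_le_one_sub_exp_neg h.le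
    nlinarith [norm_nonneg w]

end Kernels

/-! ### Nonvanishing characteristic functions, distinguished logarithms and roots -/

section Roots

instance isProbabilityMeasure_convPow (η : Measure ℝ) [IsProbabilityMeasure η] (n : ℕ) :
    IsProbabilityMeasure (convPow η n) := by
  induction n with
  | zero => unfold convPow; infer_instance
  | succ n ih => unfold convPow; infer_instance

theorem charFun_convPow (η : Measure ℝ) [IsProbabilityMeasure η] (n : ℕ) (t : ℝ) :
    charFun (convPow η n) t = charFun η t ^ n := by
  induction n with
  | zero => simp [convPow, charFun_dirac]
  | succ n ih => rw [convPow, charFun_conv, ih, pow_succ]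

theorem integrable_exp_mul_I (μ : Measure ℝ) [IsFiniteMeasure μ] (t : ℝ) :
    Integrable (fun x : ℝ => Complex.exp (t * x * Complex.I)) μ := by
  refine Integrable.of_bound (by fun_prop) 1 (Eventually.of_forall fun x => ?_)
  rw [← Complex.ofReal_mul, Complex.norm_exp_ofReal_mul_I]

theorem re_charFun (μ : Measure ℝ) [IsFiniteMeasure μ] (t : ℝ) :
    (charFun μ t).re = ∫ x, Real.cos (t * x) ∂μ := by
  rw [charFun_apply_real, ← RCLike.re_eq_complex_re, ← integral_re (integrable_exp_mul_I μ t)]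
  refine integral_congr_ae (Eventually.of_forall fun x => ?_)
  simp only [RCLike.re_eq_complex_re]
  rw [← Complex.ofReal_mul, Complex.exp_ofReal_mul_I_re]

theorem im_charFun (μ : Measure ℝ) [IsFiniteMeasure μ] (t : ℝ) :
    (charFun μ t).im = ∫ x, Real.sin (t * x) ∂μ := by
  rw [charFun_apply_real, ← RCLike.im_eq_complex_im, ← integral_im (integrable_exp_mul_I μ t)]
  refine integral_congr_ae (Eventually.of_forall fun x => ?_)
  simp only [RCLike.im_eq_complex_im]
  rw [← Complex.ofReal_mul, Complex.exp_ofReal_mul_I_im]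

theorem one_sub_re_charFun_two_mul_le (μ : Measure ℝ) [IsProbabilityMeasure μ] (t : ℝ) :
    1 - (charFun μ (2 * t)).re ≤ 4 * (1 - (charFun μ t).re) := by
  have hint : ∀ s : ℝ, Integrable (fun x => Real.cos (s * x)) μ := fun s =>
    Integrable.of_bound (by fun_prop) 1
      (Eventually.of_forall fun x => by simpa using Real.abs_cos_le_one (s * x))
  rw [re_charFun, re_charFun]
  have h := integral_mono ((integrable_const (1 : ℝ)).sub (hint (2 * t)))
    (((integrable_const (1 : ℝ)).sub (hint t)).const_mul 4) (fun x => ?_)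
  · simp only [Pi.sub_apply] at h
    rw [integral_const_mul, integral_sub (integrable_const _) (hint _),
      integral_sub (integrable_const _) (hint _)] at h
    simpa using h
  · simp only [Pi.sub_apply]
    have e : Real.cos (2 * t * x) = 2 * Real.cos (t * x) ^ 2 - 1 := by
      rw [mul_assoc, Real.cos_two_mul]
    rw [e]
    nlinarith [sq_nonneg (1 - Real.cos (t * x)), Real.cos_le_one (t * x)]

/-- Symmetrization: `‖charFun μ‖²` is the real characteristic function of the convolution of `μ`
with its reflection. -/
theorem one_sub_norm_charFun_sq_two_mul_le (μ : Measure ℝ) [IsProbabilityMeasure μ] (t : ℝ) :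
    1 - ‖charFun μ (2 * t)‖ ^ 2 ≤ 4 * (1 - ‖charFun μ t‖ ^ 2) := by
  have : IsProbabilityMeasure (μ.map (fun x => (-1) * x)) :=
    Measure.isProbabilityMeasure_map (by fun_prop)
  have h := one_sub_re_charFun_two_mul_le (μ.conv (μ.map (fun x => (-1) * x))) t
  have e : ∀ s, (charFun (μ.conv (μ.map (fun x => (-1) * x))) s).re = ‖charFun μ s‖ ^ 2 := by
    intro s
    rw [charFun_conv, charFun_map_mul, neg_one_mul, charFun_neg, Complex.mul_conj,
      Complex.normSq_eq_norm_sq, Complex.ofReal_re]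
  rwa [e, e] at h

/-- A zero at `2t` is shared by every root, so the doubling inequality gives each root squared
modulus at most `3/4` at `t`. Then `‖charFun μ t‖² ≤ (3/4)^n` for all `n`, so `t` is a zero too.
Repeated halving would carry the zero to points near 0, where the value is near 1. -/
theorem charFun_ne_zero_of_mem_ID {μ : ProbabilityMeasure ℝ} (hμ : μ ∈ ID) (t : ℝ) :
    charFun (μ : Measure ℝ) t ≠ 0 := by
  have hdouble : ∀ t, charFun (μ : Measure ℝ) t ≠ 0 → charFun (μ : Measure ℝ) (2 * t) ≠ 0 := by
    intro t ht h2
    have hb : ∀ n : ℕ, ‖charFun (μ : Measure ℝ) t‖ ^ 2 ≤ (3 / 4 : ℝ) ^ n := by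
      intro n
      rcases Nat.eq_zero_or_pos n with rfl | hn
      · rw [pow_zero]
        exact pow_le_one₀ (norm_nonneg _) (norm_charFun_le_one t)
      obtain ⟨η, hη⟩ := hμ n hn
      have e : ∀ s, charFun (μ : Measure ℝ) s = charFun (η : Measure ℝ) s ^ n := fun s => by
        rw [← hη, charFun_convPow]
      have hz : charFun (η : Measure ℝ) (2 * t) = 0 :=
        pow_eq_zero_iff hn.ne' |>.mp (by rw [← e, h2])
      have h := one_sub_norm_charFun_sq_two_mul_le (η : Measure ℝ) t
      rw [hz] at h
      rw [e, norm_pow, ← pow_mul, mul_comm, pow_mul]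
      refine pow_le_pow_left₀ (sq_nonneg _) ?_ n
      norm_num at h
      linarith
    have hpos : 0 < ‖charFun (μ : Measure ℝ) t‖ ^ 2 := by positivity
    obtain ⟨n, hn⟩ := exists_pow_lt_of_lt_one hpos (by norm_num : (3 / 4 : ℝ) < 1)
    exact absurd (hb n) (not_le.mpr hn)
  have hlim : Tendsto (fun k : ℕ => charFun (μ : Measure ℝ) (t * (1 / 2) ^ k)) atTop (𝓝 1) := by
    have h1 : Tendsto (fun k : ℕ => t * (1 / 2 : ℝ) ^ k) atTop (𝓝 (t * 0)) :=
      (tendsto_pow_atTop_nhds_zero_of_lt_one (by norm_num) (by norm_num)).const_mul t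
    rw [mul_zero] at h1
    have h2 := ((continuous_charFun (μ := (μ : Measure ℝ))).tendsto 0).comp h1
    simpa [Function.comp_def] using h2
  obtain ⟨k, hk⟩ := (hlim.eventually (isOpen_ne.mem_nhds one_ne_zero)).exists
  clear hlim
  induction k with
  | zero => simpa using hk
  | succ k ih =>
    refine ih ?_
    have := hdouble _ hk
    rwa [show 2 * (t * (1 / 2 : ℝ) ^ (k + 1)) = t * (1 / 2) ^ k by rw [pow_succ]; ring] at this

/-- The function takes values in the discrete group `2πiℤ`, hence is constant on a preconnected set.
-/
theorem eq_zero_of_exp_eq_one {S : Set ℝ} (hS : IsPreconnected S) {g : ℝ → ℂ}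
    (hg : ContinuousOn g S) (hexp : ∀ x ∈ S, Complex.exp (g x) = 1) {x₀ : ℝ} (hx₀ : x₀ ∈ S)
    (h0 : g x₀ = 0) {x : ℝ} (hx : x ∈ S) : g x = 0 := by
  let T : AddSubgroup ℂ := AddSubgroup.zmultiples (2 * Real.pi * Complex.I)
  have hT : DiscreteTopology T := NormedSpace.discreteTopology_zmultiples _
  have hmaps : Set.MapsTo g S (T : Set ℂ) := by
    intro y hy
    obtain ⟨n, hn⟩ := Complex.exp_eq_one_iff.mp (hexp y hy)
    exact ⟨n, by simp [hn]⟩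
  have hT' : IsDiscrete (T : Set ℂ) := ⟨hT⟩
  obtain ⟨c, -, hc⟩ := hS.eqOn_const_of_mapsTo hT' hg hmaps ⟨0, T.zero_mem⟩
  exact (hc hx).trans ((hc hx₀).symm.trans h0)

theorem exists_continuous_log {f : ℝ → ℂ} (hf : Continuous f) (hne : ∀ x, f x ≠ 0) (h0 : f 0 = 1) :
    ∃ φ : ℝ → ℂ, Continuous φ ∧ φ 0 = 0 ∧ ∀ x, f x = Complex.exp (φ x) := by
  obtain ⟨F, ⟨hF0, hF⟩, -⟩ := Complex.isCoveringMapOn_exp.existsUnique_continuousMap_lifts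
    ⟨f, hf⟩ (a₀ := 0) (e₀ := 0) (by simp [h0]) (fun a => hne a)
  exact ⟨F, F.continuous, hF0, fun x => (congrFun hF x).symm⟩

theorem IsCharExponent.unique {μ : ProbabilityMeasure ℝ} {φ ψ : ℝ → ℂ}
    (hφ : IsCharExponent μ φ) (hψ : IsCharExponent μ ψ) : φ = ψ := by
  funext x
  refine sub_eq_zero.mp (eq_zero_of_exp_eq_one (g := fun x => φ x - ψ x) isPreconnected_univ
    (hφ.1.sub hψ.1).continuousOn (fun y _ => ?_) (Set.mem_univ 0) ?_ (Set.mem_univ x))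
  · rw [Complex.exp_sub, ← hφ.2.2, ← hψ.2.2, div_self]
    rw [hφ.2.2]; exact Complex.exp_ne_zero _
  · simp [hφ.2.1, hψ.2.1]

theorem exists_isCharExponent {μ : ProbabilityMeasure ℝ} (hμ : μ ∈ ID) :
    ∃ φ, IsCharExponent μ φ := by
  obtain ⟨φ, h1, h2, h3⟩ := exists_continuous_log (f := charFun (μ : Measure ℝ))
    continuous_charFun (charFun_ne_zero_of_mem_ID hμ) (by simp)
  exact ⟨φ, h1, h2, h3⟩

theorem IsCharExponent.re_nonpos {μ : ProbabilityMeasure ℝ} {φ : ℝ → ℂ}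
    (hφ : IsCharExponent μ φ) (z : ℝ) : (φ z).re ≤ 0 := by
  have h := norm_charFun_le_one (μ := (μ : Measure ℝ)) z
  rwa [hφ.2.2, Complex.norm_exp, Real.exp_le_one_iff] at h

/-- If `ψ` is the continuous logarithm of the root, then `n ψ` is an exponent of `μ`, hence equals
`φ` by uniqueness. -/
theorem IsCharExponent.charFun_root {μ η : ProbabilityMeasure ℝ} {φ : ℝ → ℂ}
    (hφ : IsCharExponent μ φ) {n : ℕ} (hn : 0 < n)
    (hη : convPow (η : Measure ℝ) n = (μ : Measure ℝ)) (z : ℝ) :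
    charFun (η : Measure ℝ) z = Complex.exp (φ z / n) := by
  have e : ∀ s, charFun (μ : Measure ℝ) s = charFun (η : Measure ℝ) s ^ n := fun s => by
    rw [← hη, charFun_convPow]
  obtain ⟨ψ, h1, h2, h3⟩ := exists_continuous_log (f := charFun (η : Measure ℝ))
    continuous_charFun (fun x hx => by
      have := hφ.2.2 x
      rw [e, hx, zero_pow hn.ne'] at this
      exact Complex.exp_ne_zero _ this.symm) (by simp)
  have hψ : IsCharExponent μ (fun x => n * ψ x) :=
    ⟨by fun_prop, by simp [h2], fun z => by rw [e, h3, ← Complex.exp_nat_mul]⟩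
  have hn' : (n : ℂ) ≠ 0 := by exact_mod_cast hn.ne'
  rw [h3, hφ.unique hψ, mul_div_cancel_left₀ _ hn']

/-- With `w = φ t` this bounds `n ‖1 - charFun η_n t‖` uniformly in `n`, the source of the mass
bound for Lévy-Khintchine and of all tail bounds below. -/
theorem norm_mul_one_sub_exp_div_le {w : ℂ} (hw : w.re ≤ 0) {n : ℕ} (hn : 0 < n) :
    n * ‖1 - Complex.exp (w / n)‖ ≤ ‖w‖ := by
  have hn' : (0 : ℝ) < n := by exact_mod_cast hn
  have h := norm_exp_sub_one_le_of_re_nonpos (w := w / n) (by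
    rw [Complex.div_natCast_re]; exact div_nonpos_of_nonpos_of_nonneg hw hn'.le)
  rw [norm_sub_rev]
  rw [norm_div, Complex.norm_natCast, le_div_iff₀ hn'] at h
  linarith

theorem tendsto_mul_exp_div_sub_one (w : ℂ) :
    Tendsto (fun n : ℕ => (n : ℂ) * (Complex.exp (w / n) - 1)) atTop (𝓝 w) := by
  have d : HasDerivAt (fun x : ℂ => Complex.exp (x * w)) w 0 := by
    have := ((hasDerivAt_id (0 : ℂ)).mul_const w).cexp
    simpa using this
  have h := hasDerivAt_iff_tendsto_slope.mp d
  have hn : Tendsto (fun n : ℕ => ((n : ℂ))⁻¹) atTop (𝓝[≠] 0) := by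
    refine tendsto_nhdsWithin_iff.mpr ⟨tendsto_inv_atTop_nhds_zero_nat (𝕜 := ℂ), ?_⟩
    filter_upwards [eventually_gt_atTop 0] with n hn
    exact inv_ne_zero (by exact_mod_cast hn.ne')
  refine (h.comp hn).congr fun n => ?_
  simp only [Function.comp, slope_def_module, sub_zero, inv_inv, smul_eq_mul, zero_mul,
    Complex.exp_zero]
  rw [inv_mul_eq_div]

end Roots

/-! ### Lévy's continuity theorem and real convolution powers -/

section LevyContinuity

/-- If characteristic functions converge pointwise to a function continuous at `0`, the limit is
the characteristic function of a probability measure. -/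
theorem exists_charFun_eq_of_tendsto {η : ℕ → ProbabilityMeasure ℝ} {f : ℝ → ℂ}
    (hf : ContinuousAt f 0)
    (h : ∀ t, Tendsto (fun n => charFun (η n : Measure ℝ) t) atTop (𝓝 (f t))) :
    ∃ μ : ProbabilityMeasure ℝ, ∀ t, charFun (μ : Measure ℝ) t = f t := by
  have ht : IsTightMeasureSet (Set.range fun n => (η n : Measure ℝ)) :=
    isTightMeasureSet_of_tendsto_charFun hf h
  have hc : IsCompact (closure (Set.range η)) :=
    isCompact_closure_of_isTightMeasureSet (by
      convert! ht using 1; ext; simp)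
  obtain ⟨μ, -, k, hk, hlim⟩ := hc.tendsto_subseq (x := η)
    (fun n => subset_closure (Set.mem_range_self n))
  refine ⟨μ, fun t => tendsto_nhds_unique ?_ ((h t).comp hk.tendsto_atTop)⟩
  exact ProbabilityMeasure.tendsto_iff_tendsto_charFun.mp hlim t

/-- The `⌊s n⌋`-th convolution power of an `n`-th root has characteristic function `exp((⌊s n⌋ / n)
φ)`; let `n → ∞`. -/
theorem exists_convRPow {μ : ProbabilityMeasure ℝ} (hμ : μ ∈ ID) {φ : ℝ → ℂ}
    (hφ : IsCharExponent μ φ) {s : ℝ} (hs : 0 ≤ s) :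
    ∃ η : ProbabilityMeasure ℝ, ∀ z, charFun (η : Measure ℝ) z = Complex.exp (s * φ z) := by
  choose η hη using fun n : ℕ => hμ (n + 1) n.succ_pos
  refine exists_charFun_eq_of_tendsto (η := fun n : ℕ =>
    (⟨convPow (η n : Measure ℝ) ⌊s * ((n + 1 : ℕ) : ℝ)⌋₊, inferInstance⟩ : ProbabilityMeasure ℝ))
    ?_ (fun t => ?_)
  · have := hφ.1; fun_prop
  · simp only [ProbabilityMeasure.coe_mk]
    have e : ∀ n : ℕ, charFun (convPow (η n : Measure ℝ) ⌊s * ((n + 1 : ℕ) : ℝ)⌋₊) t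
        = Complex.exp (((⌊s * ((n + 1 : ℕ) : ℝ)⌋₊ / ((n + 1 : ℕ) : ℝ) : ℝ) : ℂ) * φ t) := by
      intro n
      rw [charFun_convPow, hφ.charFun_root n.succ_pos (hη n), ← Complex.exp_nat_mul]
      congr 1
      push_cast
      ring
    simp_rw [e]
    refine (Complex.continuous_exp.tendsto _).comp (Tendsto.mul_const _ ?_)
    refine (Complex.continuous_ofReal.tendsto _).comp ?_
    exact (tendsto_nat_floor_mul_div_atTop hs).comp
      (tendsto_natCast_atTop_atTop.comp (tendsto_add_atTop_nat 1))

theorem charFun_convRPow {μ : ProbabilityMeasure ℝ} (hμ : μ ∈ ID) {φ : ℝ → ℂ}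
    (hφ : IsCharExponent μ φ) {s : ℝ} (hs : 0 ≤ s) (z : ℝ) :
    charFun (convRPow μ s : Measure ℝ) z = Complex.exp (s * φ z) := by
  obtain ⟨η, hη⟩ := exists_convRPow hμ hφ hs
  obtain ⟨ψ, hψ, h⟩ := Classical.epsilon_spec (p := fun η : ProbabilityMeasure ℝ =>
    ∃ φ : ℝ → ℂ, IsCharExponent μ φ ∧
      ∀ z : ℝ, charFun (η : Measure ℝ) z = Complex.exp ((s : ℂ) * φ z)) ⟨η, φ, hφ, hη⟩
  rw [hφ.unique hψ]
  exact h z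

end LevyContinuity

/-! ### Compactness of rescaled convolution roots -/

section Compactness

theorem charFun_eq_integral_exp_I (μ : Measure ℝ) (z : ℝ) :
    charFun μ z = ∫ x : ℝ, Complex.exp (Complex.I * z * x) ∂μ := by
  rw [charFun_apply_real]
  congr 1; ext x; congr 1; ring

theorem integrable_exp_I (μ : Measure ℝ) [IsFiniteMeasure μ] (z : ℝ) :
    Integrable (fun x : ℝ => Complex.exp (Complex.I * z * x)) μ := by
  refine (integrable_exp_mul_I μ z).congr (Eventually.of_forall fun x => ?_)
  simp only; congr 1; ring

/-- Integrating `1 - charFun η` over `[-1, 1]` gives `2 ∫ (1 - sinc) dη`. -/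
theorem integral_one_sub_sinc_le {η : Measure ℝ} [IsProbabilityMeasure η] {B : ℝ}
    (hB : ∀ t : ℝ, |t| ≤ 1 → ‖1 - charFun η t‖ ≤ B) : ∫ x, (1 - Real.sinc x) ∂η ≤ B := by
  have h1 := integral_charFun_Icc (μ := η) one_pos
  simp only [one_mul, Complex.ofReal_one, mul_one] at h1
  have h2 : ∫ t in (-1 : ℝ)..1, (1 - charFun η t) = ((2 * ∫ x, (1 - Real.sinc x) ∂η : ℝ) : ℂ) := by
    rw [intervalIntegral.integral_sub intervalIntegrable_const intervalIntegrable_charFun, h1,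
      integral_sub (integrable_const _) Real.integrable_sinc]
    simp
    ring
  have h3 := intervalIntegral.norm_integral_le_of_norm_le_const (a := (-1 : ℝ)) (b := 1)
    (f := fun t => 1 - charFun η t) (C := B) (fun t ht => by
      rw [Set.uIoc_of_le (by norm_num)] at ht
      exact hB t (abs_le.mpr ⟨ht.1.le, ht.2⟩))
  rw [h2, Complex.norm_real] at h3
  have h4 := (Real.le_norm_self _).trans h3
  norm_num at h4
  linarith

/-- Compactness: weighted measures `a n • w • η n` with bounded mass and uniformly small tails
converge weakly along an ultrafilter. -/
theorem exists_limit_weighted {η : ℕ → ProbabilityMeasure ℝ} {a : ℕ → ℝ} (ha : ∀ n, 0 ≤ a n)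
    {w : ℝ → ℝ} (hw : Continuous w) (hw0 : ∀ x, 0 ≤ w x) (hw2 : ∀ x, w x ≤ 2) {C : ℝ}
    (hC : ∀ n, a n * ∫ x, w x ∂(η n : Measure ℝ) ≤ C)
    (htight : ∀ ε > 0, ∃ R : ℝ, ∀ n, a n * (η n : Measure ℝ).real {x | R < |x|} ≤ ε) :
    ∃ κ : FiniteMeasure ℝ, ∀ h : ℝ → ℂ, Continuous h → (∃ D, ∀ x, ‖h x‖ ≤ D) →
      Tendsto (fun n => ∫ x, ((a n * w x : ℝ) : ℂ) * h x ∂(η n : Measure ℝ))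
        (hyperfilter ℕ : Filter ℕ) (𝓝 (∫ x, h x ∂(κ : Measure ℝ))) := by
  have hwint : ∀ n, Integrable (fun x => a n * w x) (η n : Measure ℝ) := fun n =>
    (Integrable.of_bound hw.aestronglyMeasurable 2 (Eventually.of_forall fun x => by
      rw [Real.norm_of_nonneg (hw0 x)]; exact hw2 x)).const_mul _
  have hwa : ∀ n x, 0 ≤ a n * w x := fun n x => mul_nonneg (ha n) (hw0 x)
  let m : ℕ → Measure ℝ := fun n =>
    (η n : Measure ℝ).withDensity (fun x => ENNReal.ofReal (a n * w x))
  have hmass : ∀ n, m n Set.univ ≤ ENNReal.ofReal C := by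
    intro n
    simp only [m]
    rw [withDensity_apply _ MeasurableSet.univ, Measure.restrict_univ,
      ← ofReal_integral_eq_lintegral_ofReal (hwint n) (Eventually.of_forall (hwa n)),
      integral_const_mul]
    exact ENNReal.ofReal_le_ofReal (hC n)
  have hfin : ∀ n, IsFiniteMeasure (m n) := fun n =>
    ⟨(hmass n).trans_lt ENNReal.ofReal_lt_top⟩
  let M : ℕ → FiniteMeasure ℝ := fun n => ⟨m n, hfin n⟩
  -- The extra factor `1/2` absorbs the bound `w ≤ 2` in the tail estimate.
  choose R hR using fun k : ℕ => htight (1 / ((k : ℝ) + 1) / 2) (by positivity)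
  let u : ℕ → NNReal := fun k => ⟨1 / ((k : ℝ) + 1), by positivity⟩
  have hu : Tendsto u atTop (𝓝 0) := by
    rw [← NNReal.tendsto_coe]
    exact tendsto_one_div_add_atTop_nhds_zero_nat
  have hcpt := isCompact_setOfPred_finiteMeasure_mass_le_compl_isCompact_le (E := ℝ)
    (u := u) (K := fun k => Metric.closedBall 0 (R k)) C.toNNReal hu
    (fun k => isCompact_closedBall _ _) (Or.inl inferInstance)
  have hmem : ∀ n, M n ∈ {μ : FiniteMeasure ℝ | μ.mass ≤ C.toNNReal ∧
      ∀ k, μ (Metric.closedBall 0 (R k))ᶜ ≤ u k} := by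
    intro n
    refine ⟨?_, fun k => ?_⟩
    · rw [← ENNReal.coe_le_coe, FiniteMeasure.ennreal_mass]
      exact hmass n
    · rw [← ENNReal.coe_le_coe, FiniteMeasure.ennreal_coeFn_eq_coeFn_toMeasure]
      change m n _ ≤ _
      have hset : (Metric.closedBall (0 : ℝ) (R k))ᶜ = {x | R k < |x|} := by
        ext x; simp
      have hms : MeasurableSet {x : ℝ | R k < |x|} := by
        rw [← hset]; exact Metric.isClosed_closedBall.measurableSet.compl
      rw [hset]
      simp only [m]
      rw [withDensity_apply _ hms]
      calc ∫⁻ x in {x | R k < |x|}, ENNReal.ofReal (a n * w x) ∂(η n : Measure ℝ)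
          ≤ ∫⁻ x in {x | R k < |x|}, ENNReal.ofReal (a n * 2) ∂(η n : Measure ℝ) :=
            lintegral_mono fun x => ENNReal.ofReal_le_ofReal
              (mul_le_mul_of_nonneg_left (hw2 x) (ha n))
        _ = ENNReal.ofReal (a n * 2 * (η n : Measure ℝ).real {x | R k < |x|}) := by
            rw [setLIntegral_const, ENNReal.ofReal_mul (p := a n * 2) (by have := ha n; positivity),
              ofReal_measureReal]
        _ ≤ ENNReal.ofReal (1 / ((k : ℝ) + 1)) := ENNReal.ofReal_le_ofReal (by
            have := hR k n; linarith)
        _ = u k := ENNReal.ofReal_eq_coe_nnreal _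
  -- An ultrafilter in a compact set converges, so one limit serves all test functions and no
  -- subsequence is extracted.
  obtain ⟨κ, -, hκ⟩ := hcpt.ultrafilter_le_nhds ((hyperfilter ℕ).map M)
    (by
      rw [Ultrafilter.coe_map, le_principal_iff, mem_map]
      exact Eventually.of_forall hmem)
  refine ⟨κ, fun h hh ⟨D, hD⟩ => ?_⟩
  have hκ' : Tendsto M (hyperfilter ℕ : Filter ℕ) (𝓝 κ) := hκ
  have := (FiniteMeasure.tendsto_iff_forall_integral_rclike_tendsto ℂ).mp hκ'
    (BoundedContinuousFunction.ofNormedAddCommGroup h hh D hD)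
  simp only [BoundedContinuousFunction.coe_ofNormedAddCommGroup] at this
  refine this.congr fun n => ?_
  change ∫ x, h x ∂(m n) = _
  simp only [m]
  rw [integral_withDensity_eq_integral_toReal_smul (by fun_prop)
    (Eventually.of_forall fun _ => ENNReal.ofReal_lt_top)]
  refine integral_congr_ae (Eventually.of_forall fun x => ?_)
  simp only
  rw [ENNReal.toReal_ofReal (hwa n x), Complex.real_smul]

/-- Tails are controlled by the integral of `1 - charFun` near 0, and there `n ‖1 - charFun η_n‖ ≤
‖φ‖`, which is small by continuity at 0, uniformly in `n`. -/
theorem IsCharExponent.tail_root_le {μ : ProbabilityMeasure ℝ} {φ : ℝ → ℂ}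
    (hφ : IsCharExponent μ φ) {η : ℕ → ProbabilityMeasure ℝ}
    (hη : ∀ n, convPow (η n : Measure ℝ) (n + 1) = (μ : Measure ℝ)) {ε : ℝ} (hε : 0 < ε) :
    ∃ R : ℝ, ∀ n, ((n + 1 : ℕ) : ℝ) * (η n : Measure ℝ).real {x | R < |x|} ≤ ε := by
  have hc := hφ.1.tendsto 0
  rw [hφ.2.1, Metric.tendsto_nhds_nhds] at hc
  obtain ⟨δ, hδ, hδε⟩ := hc (ε / 2) (by positivity)
  -- For `R = 4/δ` the integration runs over `|t| ≤ 2/R = δ/2`, inside the region where `‖φ‖ < ε/2`.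
  have hR : 0 < 4 / δ := by positivity
  refine ⟨4 / δ, fun n => ?_⟩
  have hn : (0 : ℝ) < ((n + 1 : ℕ) : ℝ) := by positivity
  have h1 := measureReal_abs_gt_le_integral_charFun (μ := (η n : Measure ℝ)) hR
  have h2 := intervalIntegral.norm_integral_le_of_norm_le_const (a := -2 * (4 / δ)⁻¹)
    (b := 2 * (4 / δ)⁻¹) (f := fun t => 1 - charFun (η n : Measure ℝ) t)
    (C := ε / 2 / ((n + 1 : ℕ) : ℝ)) (fun t ht => by
      rw [Set.uIoc_of_le (by rw [neg_mul]; exact neg_le_self (by positivity))] at ht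
      have e : (2 : ℝ) * (4 / δ)⁻¹ = δ / 2 := by field_simp; norm_num
      rw [neg_mul, e] at ht
      have ht' : |t| < δ := by
        rw [abs_lt]; constructor <;> linarith [ht.1, ht.2]
      have h3 := hδε (x := t) (by simpa using ht')
      rw [dist_zero_right] at h3
      have h4 := norm_mul_one_sub_exp_div_le (hφ.re_nonpos t) n.succ_pos
      rw [hφ.charFun_root n.succ_pos (hη n), le_div_iff₀ hn]
      linarith)
  have e : |2 * (4 / δ)⁻¹ - -2 * (4 / δ)⁻¹| = δ := by
    rw [abs_of_nonneg (by rw [neg_mul, sub_neg_eq_add]; positivity)]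
    field_simp; norm_num
  rw [e] at h2
  calc ((n + 1 : ℕ) : ℝ) * (η n : Measure ℝ).real {x | 4 / δ < |x|}
      ≤ ((n + 1 : ℕ) : ℝ) * (2⁻¹ * (4 / δ) * (ε / 2 / ((n + 1 : ℕ) : ℝ) * δ)) := by
        gcongr
        exact h1.trans (by gcongr)
    _ = ε := by field_simp; norm_num

end Compactness

/-! ### Integrability against Lévy measures and continuity of exponents -/

section LevyMeasures

theorem _root_.MeasureTheory.Integrable.complexOfReal {α : Type*} {mα : MeasurableSpace α}
    {μ : Measure α} {f : α → ℝ} (hf : Integrable f μ) : Integrable (fun x => (f x : ℂ)) μ :=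
  hf.ofReal

theorem integrable_of_norm_le_mul {E : Type*} [NormedAddCommGroup E] {ν : Measure ℝ} {g : ℝ → ℝ}
    (hg : Measurable g) (hg0 : ∀ x, 0 ≤ g x) (hfin : ∫⁻ x, ENNReal.ofReal (g x) ∂ν < ∞)
    {f : ℝ → E} (hf : AEStronglyMeasurable f ν) {C : ℝ} (hC : ∀ x, ‖f x‖ ≤ C * g x) :
    Integrable f ν := by
  have hgi : Integrable g ν :=
    ⟨hg.aestronglyMeasurable, by
      rwa [hasFiniteIntegral_iff_ofReal (Eventually.of_forall hg0)]⟩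
  exact (hgi.const_mul C).mono' hf (Eventually.of_forall hC)

theorem IsLevyMeasure.integrable {E : Type*} [NormedAddCommGroup E] {ν : Measure ℝ}
    (hν : IsLevyMeasure ν) {f : ℝ → E} (hf : AEStronglyMeasurable f ν) {C : ℝ}
    (hC : ∀ x, ‖f x‖ ≤ C * min 1 (x ^ 2)) : Integrable f ν :=
  integrable_of_norm_le_mul (by fun_prop) (fun x => by positivity) hν.2 hf hC

theorem IsLevyMeasure.integrable_levyIntegrand {ν : Measure ℝ} (hν : IsLevyMeasure ν) (z : ℝ) :
    Integrable (fun x : ℝ => Complex.exp (Complex.I * z * x) - 1 - Complex.I * (tau x) * z) ν := by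
  refine hν.integrable ?_ (norm_levyIntegrand_tau_le z)
  have := measurable_tau
  exact Measurable.aestronglyMeasurable (by fun_prop)

theorem isCharExponent_levyExponent {μ : ProbabilityMeasure ℝ} {γ b : ℝ} {ν : Measure ℝ}
    (h : HasTriplet μ γ b ν) : IsCharExponent μ (levyExponent tau γ b ν) := by
  obtain ⟨-, hν, hchar⟩ := h
  refine ⟨?_, by simp [levyExponent], hchar⟩
  unfold levyExponent
  refine Continuous.add (by fun_prop) ?_
  rw [continuous_iff_continuousAt]
  intro z
  have hb : Integrable (fun x : ℝ => 3 * ((|z| + 1) ^ 2 + 1) * min 1 (x ^ 2)) ν :=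
    hν.integrable (Measurable.aestronglyMeasurable (by fun_prop))
      (C := 3 * ((|z| + 1) ^ 2 + 1)) (fun x => by rw [Real.norm_of_nonneg (by positivity)])
  refine continuousAt_of_dominated (Eventually.of_forall fun y =>
    (hν.integrable_levyIntegrand y).aestronglyMeasurable) ?_ hb
    (Eventually.of_forall fun x => by fun_prop)
  filter_upwards [Metric.ball_mem_nhds z one_pos] with y hy
  refine Eventually.of_forall fun x => (norm_levyIntegrand_tau_le y x).trans ?_
  have hy' : |y - z| < 1 := by simpa [Real.dist_eq] using hy
  have : |y| ≤ |z| + 1 := by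
    have := abs_sub_abs_le_abs_sub y z
    linarith
  gcongr 3 * (?_ + 1) * _
  rw [← sq_abs]
  gcongr

theorem isCharExponent_levyExponent_tauZero {μ : ProbabilityMeasure ℝ} {β₀ : ℝ} {ρ : Measure ℝ}
    (h : HasPair μ β₀ ρ) : IsCharExponent μ (levyExponent tauZero β₀ 0 ρ) := by
  obtain ⟨-, hρ, hchar⟩ := h
  refine ⟨?_, by simp [levyExponent, tauZero], hchar⟩
  have hm : Measurable tauZero := measurable_const
  unfold levyExponent
  refine Continuous.add (by fun_prop) ?_
  rw [continuous_iff_continuousAt]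
  intro z
  have hb : Integrable (fun x : ℝ => ((|z| + 1) + 2) * min 1 |x|) ρ :=
    integrable_of_norm_le_mul (g := fun x => min 1 |x|) (by fun_prop) (fun x => by positivity) hρ
      (Measurable.aestronglyMeasurable (by fun_prop))
      (C := (|z| + 1) + 2) (fun x => by rw [Real.norm_of_nonneg (by positivity)])
  refine continuousAt_of_dominated (Eventually.of_forall fun y =>
    Measurable.aestronglyMeasurable (by fun_prop)) ?_ hb
    (Eventually.of_forall fun x => by fun_prop)
  filter_upwards [Metric.ball_mem_nhds z one_pos] with y hy
  refine Eventually.of_forall fun x => (norm_levyIntegrand_tauZero_le y x).trans ?_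
  have hy' : |y - z| < 1 := by simpa [Real.dist_eq] using hy
  have : |y| ≤ |z| + 1 := by
    have := abs_sub_abs_le_abs_sub y z
    linarith
  gcongr

end LevyMeasures

/-! ### The Lévy-Khintchine representation -/

section LevyKhintchine

/-- The **Lévy-Khintchine representation**: every infinitely divisible law has a triplet. -/
theorem exists_hasTriplet {μ : ProbabilityMeasure ℝ} (hμ : μ ∈ ID) :
    ∃ γ b ν, HasTriplet μ γ b ν := by
  obtain ⟨φ, hφ⟩ := exists_isCharExponent hμ
  choose η hη using fun n : ℕ => hμ (n + 1) n.succ_pos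
  obtain ⟨B, hB⟩ := (isCompact_Icc (a := (-1 : ℝ)) (b := 1)).exists_bound_of_continuousOn
    hφ.1.continuousOn
  have hsinc : Continuous fun x : ℝ => 1 - Real.sinc x := continuous_const.sub Real.continuous_sinc
  obtain ⟨κ, hκ⟩ := exists_limit_weighted (η := η) (a := fun n => ((n + 1 : ℕ) : ℝ))
    (fun n => by positivity) hsinc one_sub_sinc_nonneg
    (fun x => by linarith [Real.neg_one_le_sinc x]) (C := B) (fun n => by
      have hn : (0 : ℝ) < ((n + 1 : ℕ) : ℝ) := by positivity
      have := integral_one_sub_sinc_le (η := (η n : Measure ℝ)) (B := B / ((n + 1 : ℕ) : ℝ))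
        (fun t ht => by
          rw [hφ.charFun_root n.succ_pos (hη n), le_div_iff₀ hn]
          have h4 := norm_mul_one_sub_exp_div_le (hφ.re_nonpos t) n.succ_pos
          have h5 := hB t (abs_le.mp ht)
          linarith)
      rwa [le_div_iff₀ hn, mul_comm] at this)
    (fun ε hε => hφ.tail_root_le hη hε)
  have hlim : ∀ z, Tendsto (fun n : ℕ => ((n + 1 : ℕ) : ℂ) * (charFun (η n : Measure ℝ) z - 1))
      (hyperfilter ℕ : Filter ℕ) (𝓝 (φ z)) := fun z => by
    have h := ((tendsto_mul_exp_div_sub_one (φ z)).comp (tendsto_add_atTop_nat 1)).mono_left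
      Nat.hyperfilter_le_atTop
    refine h.congr fun n => ?_
    rw [hφ.charFun_root n.succ_pos (hη n)]
    rfl
  have hint : ∀ (z : ℝ) n, Integrable (fun x : ℝ => Complex.exp (Complex.I * z * x) - 1)
      (η n : Measure ℝ) := fun z n => (integrable_exp_I _ z).sub (integrable_const _)
  have hsin : ∀ n, Integrable (fun x : ℝ => Real.sin x) (η n : Measure ℝ) := fun n =>
    Integrable.of_bound (by fun_prop) 1 (Eventually.of_forall fun x => Real.abs_sin_le_one x)
  -- Compensating by `sin` makes the drift coefficient the imaginary part of the same expression at
  -- `z = 1`, so its limit `(φ 1).im` is already known.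
  have hid : ∀ z n, ((n + 1 : ℕ) : ℂ) * (charFun (η n : Measure ℝ) z - 1)
      = Complex.I * z * (((((n + 1 : ℕ) : ℂ) * (charFun (η n : Measure ℝ) 1 - 1)).im : ℝ) : ℂ)
        + ∫ x, ((((n + 1 : ℕ) : ℝ) * (1 - Real.sinc x) : ℝ) : ℂ) * levyKernel z x
          ∂(η n : Measure ℝ) := by
    intro z n
    have e1 : (((n + 1 : ℕ) : ℂ) * (charFun (η n : Measure ℝ) 1 - 1)).im
        = ((n + 1 : ℕ) : ℝ) * ∫ x, Real.sin x ∂(η n : Measure ℝ) := by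
      rw [← Complex.ofReal_natCast, Complex.im_ofReal_mul, Complex.sub_im, Complex.one_im,
        sub_zero, im_charFun]
      simp
    have e2 : ∀ x, ((((n + 1 : ℕ) : ℝ) * (1 - Real.sinc x) : ℝ) : ℂ) * levyKernel z x
        = ((n + 1 : ℕ) : ℂ) * ((Complex.exp (Complex.I * z * x) - 1)
          - Complex.I * z * ((Real.sin x : ℝ) : ℂ)) := by
      intro x
      rw [Complex.ofReal_mul, mul_assoc, levyKernel_mul, Complex.ofReal_natCast]
      ring
    simp_rw [e2]
    rw [e1, integral_const_mul, integral_sub (hint z n) ((hsin n).complexOfReal.const_mul _),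
      integral_const_mul, integral_sub (integrable_exp_I _ z) (integrable_const _),
      ← charFun_eq_integral_exp_I, integral_complex_ofReal]
    simp
    ring
  have hrep : ∀ z, φ z = Complex.I * z * ((φ 1).im : ℂ) + ∫ x, levyKernel z x ∂(κ : Measure ℝ) := by
    intro z
    refine tendsto_nhds_unique (hlim z) ?_
    simp_rw [hid z]
    refine Tendsto.add (Tendsto.const_mul _ ?_)
      (hκ _ (continuous_levyKernel z) (exists_norm_levyKernel_le z))
    exact (Complex.continuous_ofReal.tendsto _).comp
      ((Complex.continuous_im.tendsto _).comp (hlim 1))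
  -- Undo the weight off the origin; the atom of `κ` at 0 is kept for the Gaussian part.
  let ν : Measure ℝ := ((κ : Measure ℝ).restrict {0}ᶜ).withDensity
    (fun x => ENNReal.ofReal (1 - Real.sinc x)⁻¹)
  have hdm : Measurable fun x : ℝ => ENNReal.ofReal (1 - Real.sinc x)⁻¹ :=
    hsinc.measurable.inv.ennreal_ofReal
  have hν : IsLevyMeasure ν := by
    constructor
    · refine withDensity_absolutelyContinuous _ _ ?_
      rw [Measure.restrict_apply (measurableSet_singleton 0)]
      simp
    · simp only [ν]
      rw [lintegral_withDensity_eq_lintegral_mul _ hdm (by fun_prop)]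
      refine lt_of_le_of_lt (lintegral_mono (g := fun _ => ENNReal.ofReal 40) fun x => ?_) ?_
      · simp only [Pi.mul_apply]
        rw [← ENNReal.ofReal_mul (inv_nonneg.mpr (one_sub_sinc_nonneg x))]
        refine ENNReal.ofReal_le_ofReal ?_
        rcases eq_or_ne x 0 with rfl | h0
        · simp
        · rw [inv_mul_le_iff₀ (one_sub_sinc_pos h0), mul_comm]
          exact min_one_sq_le x
      · rw [lintegral_const]
        exact ENNReal.mul_lt_top ENNReal.ofReal_lt_top (measure_lt_top _ _)
  have hνint : ∀ z, ∫ x in ({0}ᶜ : Set ℝ), levyKernel z x ∂(κ : Measure ℝ)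
      = ∫ x : ℝ, (Complex.exp (Complex.I * z * x) - 1 - Complex.I * (Real.sin x) * z) ∂ν := by
    intro z
    simp only [ν]
    rw [integral_withDensity_eq_integral_toReal_smul hdm
      (Eventually.of_forall fun _ => ENNReal.ofReal_lt_top)]
    refine setIntegral_congr_fun (measurableSet_singleton 0).compl fun x hx => ?_
    have hx : x ≠ 0 := hx
    rw [ENNReal.toReal_ofReal (inv_nonneg.mpr (one_sub_sinc_nonneg x)), ← levyKernel_mul,
      Complex.real_smul, Complex.ofReal_inv, inv_mul_cancel_left₀]
    exact_mod_cast (one_sub_sinc_pos hx).ne'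
  have hsplit : ∀ z, ∫ x, levyKernel z x ∂(κ : Measure ℝ)
      = ((κ : Measure ℝ).real {0} : ℂ) * (-3 * (z : ℂ) ^ 2)
        + ∫ x in ({0}ᶜ : Set ℝ), levyKernel z x ∂(κ : Measure ℝ) := by
    intro z
    obtain ⟨D, hD⟩ := exists_norm_levyKernel_le z
    have hi : Integrable (levyKernel z) (κ : Measure ℝ) :=
      Integrable.of_bound (continuous_levyKernel z).aestronglyMeasurable D (Eventually.of_forall hD)
    rw [← integral_add_compl (measurableSet_singleton 0) hi, integral_singleton, levyKernel_zero,
      Complex.real_smul]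
  have htsm : Measurable fun x => tau x - Real.sin x := measurable_tau.sub Real.measurable_sin
  have hts : Integrable (fun x => tau x - Real.sin x) ν :=
    hν.integrable htsm.aestronglyMeasurable (C := 80) fun x => by
      have h1 := abs_tau_sub_sin_le x
      have h2 := one_sub_sinc_le x
      rw [Real.norm_eq_abs]; linarith
  -- The atom contributes `-3 z² κ{0} = -z² b / 2`, hence `b = 6 κ{0}`; the drift is corrected for
  -- passing from `sin` to `τ`.
  refine ⟨(φ 1).im + ∫ x, (tau x - Real.sin x) ∂ν, 6 * (κ : Measure ℝ).real {0}, ν, by positivity,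
    hν, fun z => ?_⟩
  rw [hφ.2.2, hrep, hsplit, hνint]
  congr 1
  have e : ∀ x : ℝ, Complex.exp (Complex.I * z * x) - 1 - Complex.I * (Real.sin x) * z
      = (Complex.exp (Complex.I * z * x) - 1 - Complex.I * (tau x) * z)
        + Complex.I * z * ((tau x - Real.sin x : ℝ) : ℂ) := by
    intro x; push_cast; ring
  simp_rw [e]
  rw [integral_add (hν.integrable_levyIntegrand z) (hts.complexOfReal.const_mul _),
    integral_const_mul,
    integral_complex_ofReal, levyExponent]
  push_cast
  ring

end LevyKhintchine

/-! ### Roots and Laplace transforms of laws on the half-line -/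

section NonnegativeSupport

theorem conv_Iio_zero {μ ν : Measure ℝ} [SFinite μ] [SFinite ν] (hμ : μ (Set.Iio 0) = 0)
    (hν : ν (Set.Iio 0) = 0) : (μ.conv ν) (Set.Iio 0) = 0 := by
  rw [Measure.conv, Measure.map_apply (by fun_prop) measurableSet_Iio]
  have hsub : (fun x : ℝ × ℝ => x.1 + x.2) ⁻¹' Set.Iio 0
      ⊆ (Set.Iio 0 ×ˢ Set.univ) ∪ (Set.univ ×ˢ Set.Iio 0) := by
    rintro ⟨x, y⟩ h
    simp only [Set.mem_preimage, Set.mem_Iio, Set.mem_union, Set.mem_prod, Set.mem_univ, and_true,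
      true_and] at h ⊢
    by_contra! hc
    linarith [hc.1, hc.2]
  refine measure_mono_null hsub (measure_union_null ?_ ?_)
  · rw [Measure.prod_prod, hμ, zero_mul]
  · rw [Measure.prod_prod, hν, mul_zero]

/-- A sum of negative terms is negative. Consequently a root of a law on `[0, ∞)` cannot charge
`(-∞, 0)`. -/
theorem pow_le_convPow_Iio (η : Measure ℝ) [IsProbabilityMeasure η] (n : ℕ) :
    η (Set.Iio 0) ^ (n + 1) ≤ convPow η (n + 1) (Set.Iio 0) := by
  induction n with
  | zero => simp [convPow]
  | succ n ih =>
    rw [convPow, Measure.conv, Measure.map_apply (by fun_prop) measurableSet_Iio]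
    have hsub : (Set.Iio 0 ×ˢ Set.Iio 0 : Set (ℝ × ℝ))
        ⊆ (fun x : ℝ × ℝ => x.1 + x.2) ⁻¹' Set.Iio 0 := by
      rintro ⟨x, y⟩ ⟨h1, h2⟩
      exact add_neg (Set.mem_Iio.mp h1) (Set.mem_Iio.mp h2)
    refine le_trans ?_ (measure_mono hsub)
    rw [Measure.prod_prod, pow_succ]
    gcongr

theorem root_Iio_zero {μ η : Measure ℝ} [IsProbabilityMeasure η] {n : ℕ} (hn : 0 < n)
    (hη : convPow η n = μ) (hμ : μ (Set.Iio 0) = 0) : η (Set.Iio 0) = 0 := by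
  obtain ⟨m, rfl⟩ := Nat.exists_eq_succ_of_ne_zero hn.ne'
  have h := pow_le_convPow_Iio η m
  rw [hη, hμ] at h
  exact pow_eq_zero_iff (Nat.succ_ne_zero m) |>.mp (le_antisymm h zero_le)

theorem ae_nonneg_of_Iio_zero {μ : Measure ℝ} (hμ : μ (Set.Iio 0) = 0) : ∀ᵐ x ∂μ, 0 ≤ x := by
  rw [ae_iff]; simp only [not_le]; exact hμ

/-- The Laplace transform `∫ e^{x w} μ(dx)` of a law on `[0, ∞)`. -/
noncomputable def laplace (μ : Measure ℝ) (w : ℂ) : ℂ :=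
  ∫ x : ℝ, Complex.exp ((max x 0 : ℝ) * w) ∂μ

theorem norm_exp_max_mul_le {w : ℂ} (hw : w.re ≤ 0) (x : ℝ) :
    ‖Complex.exp ((max x 0 : ℝ) * w)‖ ≤ 1 := by
  rw [Complex.norm_exp, Real.exp_le_one_iff, Complex.re_ofReal_mul]
  exact mul_nonpos_of_nonneg_of_nonpos (le_max_right _ _) hw

theorem integrable_exp_max_mul (μ : Measure ℝ) [IsFiniteMeasure μ] {w : ℂ} (hw : w.re ≤ 0) :
    Integrable (fun x : ℝ => Complex.exp ((max x 0 : ℝ) * w)) μ :=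
  Integrable.of_bound (by fun_prop) 1 (Eventually.of_forall (norm_exp_max_mul_le hw))

theorem laplace_conv {μ ν : Measure ℝ} [IsProbabilityMeasure μ] [IsProbabilityMeasure ν]
    (hμ : μ (Set.Iio 0) = 0) (hν : ν (Set.Iio 0) = 0) {w : ℂ} (hw : w.re ≤ 0) :
    laplace (μ.conv ν) w = laplace μ w * laplace ν w := by
  rw [laplace, integral_conv (integrable_exp_max_mul _ hw), laplace, laplace,
    ← integral_mul_const]
  refine integral_congr_ae ?_
  filter_upwards [ae_nonneg_of_Iio_zero hμ] with x hx
  rw [← integral_const_mul]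
  refine integral_congr_ae ?_
  filter_upwards [ae_nonneg_of_Iio_zero hν] with y hy
  rw [← Complex.exp_add, max_eq_left hx, max_eq_left hy, max_eq_left (add_nonneg hx hy)]
  push_cast
  ring_nf

theorem convPow_Iio_zero {η : Measure ℝ} [IsProbabilityMeasure η] (hη : η (Set.Iio 0) = 0)
    (n : ℕ) : convPow η n (Set.Iio 0) = 0 := by
  induction n with
  | zero => simp [convPow]
  | succ n ih => exact conv_Iio_zero ih hη

theorem laplace_convPow {η : Measure ℝ} [IsProbabilityMeasure η] (hη : η (Set.Iio 0) = 0)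
    {w : ℂ} (hw : w.re ≤ 0) (n : ℕ) : laplace (convPow η n) w = laplace η w ^ n := by
  induction n with
  | zero => simp [convPow, laplace]
  | succ n ih => rw [convPow, laplace_conv (convPow_Iio_zero hη n) hη hw, ih, pow_succ]

theorem laplace_I_mul {μ : Measure ℝ} (hμ : μ (Set.Iio 0) = 0) (z : ℝ) :
    laplace μ (Complex.I * z) = charFun μ z := by
  rw [charFun_eq_integral_exp_I, laplace]
  refine integral_congr_ae ?_
  filter_upwards [ae_nonneg_of_Iio_zero hμ] with x hx
  rw [max_eq_left hx, mul_comm]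

theorem norm_laplace_le (μ : Measure ℝ) [IsProbabilityMeasure μ] {w : ℂ} (hw : w.re ≤ 0) :
    ‖laplace μ w‖ ≤ 1 := by
  have := norm_integral_le_of_norm_le_const (μ := μ)
    (Eventually.of_forall (norm_exp_max_mul_le hw))
  simpa [laplace] using this

theorem laplace_neg_one (μ : Measure ℝ) :
    laplace μ (-1) = ((∫ x, Real.exp (-max x 0) ∂μ : ℝ) : ℂ) := by
  rw [laplace, ← integral_complex_ofReal]
  congr 1; ext x; push_cast; ring_nf

theorem integrable_exp_neg_max (μ : Measure ℝ) [IsFiniteMeasure μ] :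
    Integrable (fun x : ℝ => Real.exp (-max x 0)) μ :=
  Integrable.of_bound (by fun_prop) 1 (Eventually.of_forall fun x => by
    rw [Real.norm_of_nonneg (Real.exp_pos _).le, Real.exp_le_one_iff, neg_nonpos]
    exact le_max_right _ _)

theorem integral_exp_neg_max_pos (μ : Measure ℝ) [IsProbabilityMeasure μ] :
    0 < ∫ x, Real.exp (-max x 0) ∂μ := by
  rw [integral_pos_iff_support_of_nonneg (fun x => (Real.exp_pos _).le) (integrable_exp_neg_max μ)]
  have : Function.support (fun x : ℝ => Real.exp (-max x 0)) = Set.univ := by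
    ext x; simp [Real.exp_ne_zero]
  rw [this]; simp

theorem norm_pow_sub_pow_le {a b : ℂ} (ha : ‖a‖ ≤ 1) (hb : ‖b‖ ≤ 1) (n : ℕ) :
    ‖a ^ n - b ^ n‖ ≤ n * ‖a - b‖ := by
  induction n with
  | zero => simp
  | succ n ih =>
    have e : a ^ (n + 1) - b ^ (n + 1) = (a ^ n - b ^ n) * a + b ^ n * (a - b) := by ring
    rw [e]
    refine (norm_add_le _ _).trans ?_
    rw [norm_mul, norm_mul, norm_pow]
    have h1 : ‖a ^ n - b ^ n‖ * ‖a‖ ≤ ‖a ^ n - b ^ n‖ :=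
      mul_le_of_le_one_right (norm_nonneg _) ha
    have h2 : ‖b‖ ^ n * ‖a - b‖ ≤ ‖a - b‖ :=
      mul_le_of_le_one_left (norm_nonneg _) (pow_le_one₀ (norm_nonneg _) hb)
    push_cast
    linarith

end NonnegativeSupport

/-! ### Laplace exponents of infinitely divisible laws on the half-line -/

section Subordinators

/-- The Lévy-Khintchine representation of a law on `[0, ∞)`, together with its Laplace exponent
on the closed left half-plane. -/
theorem exists_hasPair {μ : ProbabilityMeasure ℝ} (hμ : μ ∈ IDPos) :
    ∃ (β₀ : ℝ) (ρ : Measure ℝ), 0 ≤ β₀ ∧ HasPair μ β₀ ρ ∧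
      ∀ w : ℂ, w.re ≤ 0 → laplace (μ : Measure ℝ) w
        = Complex.exp (β₀ * w + ∫ s in Set.Ioi (0 : ℝ), (Complex.exp (s * w) - 1) ∂ρ) := by
  obtain ⟨hID, hpos⟩ := hμ
  obtain ⟨φ, hφ⟩ := exists_isCharExponent hID
  choose η hη using fun n : ℕ => hID (n + 1) n.succ_pos
  have hη0 : ∀ n, (η n : Measure ℝ) (Set.Iio 0) = 0 := fun n =>
    root_Iio_zero n.succ_pos (hη n) hpos
  have hpow : ∀ {w : ℂ}, w.re ≤ 0 → ∀ n,
      laplace (η n : Measure ℝ) w ^ (n + 1) = laplace (μ : Measure ℝ) w := fun hw n => by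
    rw [← hη n, laplace_convPow (hη0 n) hw]
  have hwc : Continuous fun x : ℝ => 1 - Real.exp (-max x 0) := by fun_prop
  have hw0 : ∀ x : ℝ, 0 ≤ 1 - Real.exp (-max x 0) := fun x => by
    rw [sub_nonneg, Real.exp_le_one_iff, neg_nonpos]; exact le_max_right _ _
  -- The weight `1 - e^{-x}` is comparable to `1 ∧ x` on the half-line. The mass bound is `n (1 - L)
  -- ≤ -n log L`, where `L` is the Laplace transform of the root at `-1` and `L^n` is that of `μ`.
  obtain ⟨κ, hκ⟩ := exists_limit_weighted (η := η) (a := fun n => ((n + 1 : ℕ) : ℝ))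
    (fun n => by positivity) hwc hw0 (fun x => by linarith [Real.exp_pos (-max x 0)])
    (C := -Real.log (∫ x, Real.exp (-max x 0) ∂(μ : Measure ℝ))) (fun n => by
      have h1 := hpow (w := -1) (by simp) n
      rw [laplace_neg_one, laplace_neg_one] at h1
      have h2 : (∫ x, Real.exp (-max x 0) ∂(η n : Measure ℝ)) ^ (n + 1)
          = ∫ x, Real.exp (-max x 0) ∂(μ : Measure ℝ) := by exact_mod_cast h1
      rw [← h2, Real.log_pow, integral_sub (integrable_const _) (integrable_exp_neg_max _)]
      have h3 := Real.log_le_sub_one_of_pos (integral_exp_neg_max_pos (η n : Measure ℝ))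
      simp only [integral_const, probReal_univ, smul_eq_mul, mul_one]
      have hn : (0 : ℝ) ≤ ((n + 1 : ℕ) : ℝ) := by positivity
      nlinarith)
    (fun ε hε => hφ.tail_root_le hη hε)
  have hid : ∀ {w : ℂ}, w.re ≤ 0 → ∀ n,
      ∫ x, ((((n + 1 : ℕ) : ℝ) * (1 - Real.exp (-max x 0)) : ℝ) : ℂ)
      * laplaceKernel w x ∂(η n : Measure ℝ)
      = ((n + 1 : ℕ) : ℂ) * (laplace (η n : Measure ℝ) w - 1) := by
    intro w hw n
    simp_rw [Complex.ofReal_mul _ (1 - Real.exp _), mul_assoc, laplaceKernel_mul]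
    rw [integral_const_mul, integral_sub (integrable_exp_max_mul _ hw) (integrable_const _)]
    simp [laplace]
  have hlim : ∀ {w : ℂ}, w.re ≤ 0 →
      Tendsto (fun n : ℕ => ((n + 1 : ℕ) : ℂ) * (laplace (η n : Measure ℝ) w - 1))
        (hyperfilter ℕ : Filter ℕ) (𝓝 (∫ x, laplaceKernel w x ∂(κ : Measure ℝ))) := fun {w} hw =>
    (hκ _ (continuous_laplaceKernel w) ⟨_, norm_laplaceKernel_le hw⟩).congr (hid hw)
  -- No logarithm of the transform is taken: with `a` the root's transform and `b = exp(l/n)`, one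
  -- has `‖a^n - b^n‖ ≤ n ‖a - b‖`, and both `n (a - 1)` and `n (b - 1)` tend to `l`.
  have hexp : ∀ {w : ℂ}, w.re ≤ 0 → laplace (μ : Measure ℝ) w
      = Complex.exp (∫ x, laplaceKernel w x ∂(κ : Measure ℝ)) := by
    intro w hw
    set l := ∫ x, laplaceKernel w x ∂(κ : Measure ℝ) with hl
    have hre : l.re ≤ 0 := by
      refine le_of_tendsto ((Complex.continuous_re.tendsto _).comp (hlim hw))
        (Eventually.of_forall fun n => ?_)
      simp only [Function.comp]
      rw [← Complex.ofReal_natCast, Complex.re_ofReal_mul, Complex.sub_re, Complex.one_re]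
      refine mul_nonpos_of_nonneg_of_nonpos (by positivity) (sub_nonpos.mpr ?_)
      exact (Complex.re_le_norm _).trans (norm_laplace_le _ hw)
    have h1 := ((tendsto_mul_exp_div_sub_one l).comp (tendsto_add_atTop_nat 1)).mono_left
      Nat.hyperfilter_le_atTop
    have h2 := ((hlim hw).sub h1).norm
    rw [← hl, sub_self, norm_zero] at h2
    have h3 : ‖laplace (μ : Measure ℝ) w - Complex.exp l‖ ≤ 0 := by
      refine ge_of_tendsto h2 (Eventually.of_forall fun n => ?_)
      have hn : ((n + 1 : ℕ) : ℂ) ≠ 0 := by exact_mod_cast n.succ_ne_zero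
      have hb : Complex.exp l = Complex.exp (l / (n + 1 : ℕ)) ^ (n + 1) := by
        rw [← Complex.exp_nat_mul, mul_div_cancel₀ _ hn]
      have hb1 : ‖Complex.exp (l / (n + 1 : ℕ))‖ ≤ 1 := by
        rw [Complex.norm_exp, Real.exp_le_one_iff, Complex.div_natCast_re]
        exact div_nonpos_of_nonpos_of_nonneg hre (by positivity)
      rw [hb, ← hpow hw n]
      refine (norm_pow_sub_pow_le (norm_laplace_le _ hw) hb1 (n + 1)).trans (le_of_eq ?_)
      simp only [Function.comp]
      rw [← mul_sub, norm_mul, Complex.norm_natCast, sub_sub_sub_cancel_right]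
    exact sub_eq_zero.mp (norm_le_zero_iff.mp h3)
  let ρ : Measure ℝ := ((κ : Measure ℝ).restrict (Set.Ioi 0)).withDensity
    (fun x => ENNReal.ofReal (1 - Real.exp (-x))⁻¹)
  have hdm : Measurable fun x : ℝ => ENNReal.ofReal (1 - Real.exp (-x))⁻¹ := by fun_prop
  have hρ0 : ρ (Set.Iic 0) = 0 := by
    refine withDensity_absolutelyContinuous _ _ ?_
    rw [Measure.restrict_apply measurableSet_Iic, Set.Iic_inter_Ioi, Set.Ioc_self, measure_empty]
  have hrestrict : ρ.restrict (Set.Ioi 0) = ρ := by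
    refine Measure.restrict_eq_self_of_ae_mem ?_
    rw [ae_iff]
    convert! hρ0 using 2
    ext x; simp
  have hmin : ∫⁻ x, ENNReal.ofReal (min 1 |x|) ∂ρ < ∞ := by
    simp only [ρ]
    rw [lintegral_withDensity_eq_lintegral_mul _ hdm (by fun_prop)]
    refine lt_of_le_of_lt (setLIntegral_mono (g := fun _ => ENNReal.ofReal 2) measurable_const
      fun x hx => ?_) ?_
    · have hx : 0 < x := hx
      simp only [Pi.mul_apply]
      rw [← ENNReal.ofReal_mul (inv_nonneg.mpr (one_sub_exp_neg_pos hx).le)]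
      refine ENNReal.ofReal_le_ofReal ?_
      rw [inv_mul_le_iff₀ (one_sub_exp_neg_pos hx), mul_comm, abs_of_pos hx]
      exact min_one_le_one_sub_exp_neg hx.le
    · rw [setLIntegral_const]
      exact ENNReal.mul_lt_top ENNReal.ofReal_lt_top (measure_lt_top _ _)
  have hlevy : IsLevyMeasure ρ := by
    refine ⟨measure_mono_null (by simp) hρ0, lt_of_le_of_lt (lintegral_mono fun x => ?_) hmin⟩
    refine ENNReal.ofReal_le_ofReal ?_
    rcases le_total |x| 1 with h | h
    · refine min_le_min_left _ ?_
      rw [← sq_abs]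
      nlinarith [abs_nonneg x]
    · rw [min_eq_left h]; exact min_le_left _ _
  -- The kernel equals `w` on `(-∞, 0]`, so the mass of `κ` there is the drift; dividing by the
  -- weight on `(0, ∞)` gives `ρ`.
  have hint : ∀ {w : ℂ}, w.re ≤ 0 → ∫ x, laplaceKernel w x ∂(κ : Measure ℝ)
      = ((κ : Measure ℝ).real (Set.Iic 0) : ℂ) * w
        + ∫ s in Set.Ioi (0 : ℝ), (Complex.exp (s * w) - 1) ∂ρ := by
    intro w hw
    have hi : Integrable (laplaceKernel w) (κ : Measure ℝ) :=
      Integrable.of_bound (continuous_laplaceKernel w).aestronglyMeasurable _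
        (Eventually.of_forall (norm_laplaceKernel_le hw))
    rw [← integral_add_compl measurableSet_Iic hi, Set.compl_Iic]
    congr 1
    · rw [setIntegral_congr_fun measurableSet_Iic
        (fun x hx => laplaceKernel_of_nonpos w (Set.mem_Iic.mp hx)), setIntegral_const,
        Complex.real_smul]
    · rw [hrestrict]
      simp only [ρ]
      rw [integral_withDensity_eq_integral_toReal_smul hdm
        (Eventually.of_forall fun _ => ENNReal.ofReal_lt_top)]
      refine setIntegral_congr_fun measurableSet_Ioi fun x hx => ?_
      have hx : 0 < x := hx
      rw [ENNReal.toReal_ofReal (inv_nonneg.mpr (one_sub_exp_neg_pos hx).le),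
        laplaceKernel_of_pos w hx, Complex.real_smul, Complex.ofReal_inv, div_eq_inv_mul]
  refine ⟨(κ : Measure ℝ).real (Set.Iic 0), ρ, measureReal_nonneg, ⟨hlevy, hmin, fun z => ?_⟩,
    fun w hw => by rw [hexp hw, hint hw]⟩
  have hw : (Complex.I * z).re ≤ 0 := by simp
  rw [← laplace_I_mul hpos, hexp hw, hint hw, hrestrict, levyExponent]
  simp only [tauZero, Complex.ofReal_zero, mul_zero, zero_mul, sub_zero, zero_div]
  congr 2
  · ring
  · congr 1; ext x; ring_nf

end Subordinators

/-! ### Uniqueness of the drift and Lévy measure of a pair -/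

section Uniqueness

/-- A weight vanishing only at the origin, produced by second differences of exponents. -/
noncomputable def diffWeight (x : ℝ) : ℝ := 4 - 2 * Real.cos x - 2 * Real.cos (√2 * x)

theorem diffWeight_nonneg (x : ℝ) : 0 ≤ diffWeight x := by
  unfold diffWeight
  linarith [Real.cos_le_one x, Real.cos_le_one (√2 * x)]

/-- Vanishing puts both `x` and `√2 x` in `2πℤ`, which contradicts the irrationality of `√2` unless
`x = 0`. A single step would leave zeros at all multiples of a period. -/
theorem diffWeight_ne_zero {x : ℝ} (hx : x ≠ 0) : diffWeight x ≠ 0 := by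
  intro h
  unfold diffWeight at h
  have h1 : Real.cos x = 1 := by linarith [Real.cos_le_one x, Real.cos_le_one (√2 * x)]
  have h2 : Real.cos (√2 * x) = 1 := by linarith [Real.cos_le_one x, Real.cos_le_one (√2 * x)]
  obtain ⟨m, hm⟩ := (Real.cos_eq_one_iff x).mp h1
  obtain ⟨n, hn⟩ := (Real.cos_eq_one_iff _).mp h2
  have hpi : (2 * Real.pi) ≠ 0 := by positivity
  have hm0 : (m : ℝ) ≠ 0 := by
    rintro h0
    rw [h0, zero_mul] at hm
    exact hx hm.symm
  have e : (n : ℝ) = √2 * m := by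
    refine mul_right_cancel₀ hpi ?_
    rw [hn, mul_assoc, hm]
  refine irrational_sqrt_two ⟨(n : ℚ) / m, ?_⟩
  push_cast
  rw [e, mul_div_cancel_right₀ _ hm0]

theorem HasPair.integrable {μ : ProbabilityMeasure ℝ} {β : ℝ} {ρ : Measure ℝ}
    (h : HasPair μ β ρ) (z : ℝ) :
    Integrable (fun x : ℝ => Complex.exp (Complex.I * z * x) - 1 - Complex.I * (tauZero x) * z)
      ρ := by
  have hm : Measurable tauZero := measurable_const
  exact integrable_of_norm_le_mul (by fun_prop) (fun x => by positivity) h.2.1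
    (Measurable.aestronglyMeasurable (by fun_prop)) (norm_levyIntegrand_tauZero_le z)

theorem integral_four_mul_sub {ρ : Measure ℝ} {f₀ f₁ f₂ f₃ f₄ : ℝ → ℂ} (h₀ : Integrable f₀ ρ)
    (h₁ : Integrable f₁ ρ) (h₂ : Integrable f₂ ρ) (h₃ : Integrable f₃ ρ) (h₄ : Integrable f₄ ρ) :
    ∫ x, (4 * f₀ x - f₁ x - f₂ x - f₃ x - f₄ x) ∂ρ
      = 4 * ∫ x, f₀ x ∂ρ - ∫ x, f₁ x ∂ρ - ∫ x, f₂ x ∂ρ - ∫ x, f₃ x ∂ρ - ∫ x, f₄ x ∂ρ := by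
  have i₁ : Integrable (fun x => 4 * f₀ x - f₁ x) ρ := (h₀.const_mul 4).sub h₁
  have i₂ : Integrable (fun x => 4 * f₀ x - f₁ x - f₂ x) ρ := i₁.sub h₂
  have i₃ : Integrable (fun x => 4 * f₀ x - f₁ x - f₂ x - f₃ x) ρ := i₂.sub h₃
  rw [integral_sub i₃ h₄, integral_sub i₂ h₃, integral_sub i₁ h₂,
    integral_sub (h₀.const_mul 4) h₁, integral_const_mul]

/-- Second differences in `z` with steps 1 and `√2` cancel the drift and the constant `-1`, and
multiply `e^{izx}` by the weight. The exponent thus determines a finite measure equivalent to `ρ`.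
-/
theorem HasPair.charFun_withDensity {μ : ProbabilityMeasure ℝ} {β : ℝ} {ρ : Measure ℝ}
    (h : HasPair μ β ρ) (z : ℝ) :
    charFun (ρ.withDensity fun x => ENNReal.ofReal (diffWeight x)) z
      = 4 * levyExponent tauZero β 0 ρ z - levyExponent tauZero β 0 ρ (z + 1)
        - levyExponent tauZero β 0 ρ (z - 1) - levyExponent tauZero β 0 ρ (z + √2)
        - levyExponent tauZero β 0 ρ (z - √2) := by
  have hi := h.integrable
  have e : ∀ x : ℝ, (ENNReal.ofReal (diffWeight x)).toReal • Complex.exp (Complex.I * z * x)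
      = 4 * (Complex.exp (Complex.I * z * x) - 1 - Complex.I * (tauZero x) * z)
        - (Complex.exp (Complex.I * (z + 1 : ℝ) * x) - 1 - Complex.I * (tauZero x) * (z + 1 : ℝ))
        - (Complex.exp (Complex.I * (z - 1 : ℝ) * x) - 1 - Complex.I * (tauZero x) * (z - 1 : ℝ))
        - (Complex.exp (Complex.I * (z + √2 : ℝ) * x) - 1 - Complex.I * (tauZero x) * (z + √2 : ℝ))
        - (Complex.exp (Complex.I * (z - √2 : ℝ) * x) - 1
          - Complex.I * (tauZero x) * (z - √2 : ℝ)) := by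
    intro x
    have e1 : ∀ u : ℝ, Complex.exp (Complex.I * (z + u : ℝ) * x)
        + Complex.exp (Complex.I * (z - u : ℝ) * x)
        = Complex.exp (Complex.I * z * x) * (2 * Real.cos (u * x)) := by
      intro u
      rw [Complex.ofReal_cos, Complex.two_cos, mul_add, ← Complex.exp_add, ← Complex.exp_add]
      congr 2 <;> (push_cast; ring)
    have h1 := e1 1
    have h2 := e1 √2
    rw [one_mul] at h1
    rw [ENNReal.toReal_ofReal (diffWeight_nonneg x), Complex.real_smul, diffWeight]
    simp only [tauZero]
    push_cast at h1 h2 ⊢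
    linear_combination h1 + h2
  rw [charFun_eq_integral_exp_I, integral_withDensity_eq_integral_toReal_smul
    (by unfold diffWeight; fun_prop) (Eventually.of_forall fun _ => ENNReal.ofReal_lt_top)]
  simp_rw [e]
  rw [integral_four_mul_sub (hi _) (hi _) (hi _) (hi _) (hi _)]
  simp only [levyExponent]
  push_cast
  ring

theorem HasPair.isFiniteMeasure_withDensity {μ : ProbabilityMeasure ℝ} {β : ℝ} {ρ : Measure ℝ}
    (h : HasPair μ β ρ) :
    IsFiniteMeasure (ρ.withDensity fun x => ENNReal.ofReal (diffWeight x)) := by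
  refine isFiniteMeasure_withDensity_ofReal (Integrable.hasFiniteIntegral ?_)
  refine h.1.integrable (C := 8) ?_ fun x => ?_
  · exact Measurable.aestronglyMeasurable (by unfold diffWeight; fun_prop)
  · rw [Real.norm_of_nonneg (diffWeight_nonneg x), diffWeight]
    have h1 := Real.one_sub_sq_div_two_le_cos (x := x)
    have h2 := Real.one_sub_sq_div_two_le_cos (x := √2 * x)
    have h3 := Real.neg_one_le_cos x
    have h4 := Real.neg_one_le_cos (√2 * x)
    rw [mul_pow, Real.sq_sqrt (by norm_num)] at h2
    rcases le_total 1 (x ^ 2) with h | h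
    · rw [min_eq_left h]; linarith
    · rw [min_eq_right h]; nlinarith [sq_nonneg x]

theorem HasPair.unique {μ : ProbabilityMeasure ℝ} {β β' : ℝ} {ρ ρ' : Measure ℝ}
    (h : HasPair μ β ρ) (h' : HasPair μ β' ρ') : β = β' ∧ ρ = ρ' := by
  have hφ := (isCharExponent_levyExponent_tauZero h).unique (isCharExponent_levyExponent_tauZero h')
  have hf := h.isFiniteMeasure_withDensity
  have hf' := h'.isFiniteMeasure_withDensity
  have hd : (ρ.withDensity fun x => ENNReal.ofReal (diffWeight x))
      = ρ'.withDensity fun x => ENNReal.ofReal (diffWeight x) := by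
    refine Measure.ext_of_charFun (funext fun z => ?_)
    rw [h.charFun_withDensity, h'.charFun_withDensity, hφ]
  have hdm : Measurable fun x => ENNReal.ofReal (diffWeight x) := by unfold diffWeight; fun_prop
  have hne : ∀ {σ : Measure ℝ}, IsLevyMeasure σ → ∀ᵐ x ∂σ, ENNReal.ofReal (diffWeight x) ≠ 0 := by
    intro σ hσ
    filter_upwards [compl_mem_ae_iff.mpr hσ.1] with x hx
    have hx : x ≠ 0 := hx
    rw [Ne, ENNReal.ofReal_eq_zero, not_le]
    exact lt_of_le_of_ne (diffWeight_nonneg x) (diffWeight_ne_zero hx).symm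
  have hρ : ρ = ρ' := by
    rw [← withDensity_inv_same hdm (hne h.1) (Eventually.of_forall fun _ => ENNReal.ofReal_ne_top),
      hd, withDensity_inv_same hdm (hne h'.1)
        (Eventually.of_forall fun _ => ENNReal.ofReal_ne_top)]
  refine ⟨?_, hρ⟩
  subst hρ
  have h1 := congrFun hφ 1
  simp only [levyExponent] at h1
  have h2 : Complex.I * (β : ℂ) = Complex.I * β' := by
    simpa using h1
  exact_mod_cast mul_left_cancel₀ Complex.I_ne_zero h2

end Uniqueness

/-! ### The convolution semigroup as a kernel, and subordination -/

section Mixture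

/-- Clamping at 0 avoids negative exponents, where `convRPow` may be an arbitrary choice, and yields
a kernel on all of `ℝ`. -/
theorem continuous_convRPow_max {μ : ProbabilityMeasure ℝ} (hμ : μ ∈ ID) :
    Continuous fun s : ℝ => convRPow μ (max s 0) := by
  obtain ⟨φ, hφ⟩ := exists_isCharExponent hμ
  rw [continuous_iff_seqContinuous]
  intro u s hu
  refine ProbabilityMeasure.tendsto_of_tendsto_charFun fun t => ?_
  simp only [Function.comp]
  simp_rw [charFun_convRPow hμ hφ (le_max_right _ _)]
  have hc : Continuous fun s : ℝ => Complex.exp ((max s 0 : ℝ) * φ t) := by fun_prop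
  exact (hc.tendsto s).comp hu

/-- By the portmanteau theorem the mass of an open set is lower semicontinuous, and open sets form a
generating π-system. -/
theorem measurable_toMeasure_of_continuous {f : ℝ → ProbabilityMeasure ℝ} (hf : Continuous f) :
    Measurable fun s => (f s : Measure ℝ) := by
  refine Measurable.measure_of_isPiSystem_of_isProbabilityMeasure
    (BorelSpace.measurable_eq (α := ℝ)) isPiSystem_isOpen fun U hU => ?_
  refine LowerSemicontinuous.measurable fun s y hy => ?_
  have h := ProbabilityMeasure.le_liminf_measure_open_of_tendsto (hf.tendsto s) hU
  exact eventually_lt_of_lt_liminf (lt_of_lt_of_le hy h)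

/-- The convolution semigroup of an infinitely divisible law as a Markov kernel. -/
noncomputable def powKernel {μ : ProbabilityMeasure ℝ} (hμ : μ ∈ ID) : Kernel ℝ ℝ :=
  ⟨fun s => (convRPow μ (max s 0) : Measure ℝ),
    measurable_toMeasure_of_continuous (continuous_convRPow_max hμ)⟩

theorem powKernel_apply {μ : ProbabilityMeasure ℝ} (hμ : μ ∈ ID) (s : ℝ) :
    powKernel hμ s = (convRPow μ (max s 0) : Measure ℝ) := rfl

instance isMarkovKernel_powKernel {μ : ProbabilityMeasure ℝ} (hμ : μ ∈ ID) :
    IsMarkovKernel (powKernel hμ) :=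
  ⟨fun s => by rw [powKernel_apply]; infer_instance⟩

theorem charFun_powKernel {μ : ProbabilityMeasure ℝ} (hμ : μ ∈ ID) {φ : ℝ → ℂ}
    (hφ : IsCharExponent μ φ) (s z : ℝ) :
    charFun (powKernel hμ s) z = Complex.exp ((max s 0 : ℝ) * φ z) :=
  charFun_convRPow hμ hφ (le_max_right _ _) z

theorem integral_bind_kernel {E : Type*} [NormedAddCommGroup E] [NormedSpace ℝ E]
    {κ : Kernel ℝ ℝ} {ρ : Measure ℝ} {f : ℝ → E} (hf : Integrable f (ρ.bind κ)) :
    ∫ x, f x ∂(ρ.bind κ) = ∫ s, ∫ x, f x ∂(κ s) ∂ρ := by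
  rw [Measure.comp_eq_comp_const_apply] at hf ⊢
  rw [Kernel.integral_comp hf, Kernel.const_apply]

/-- The subordinated law `∫ μ^s τ(ds)`. -/
noncomputable def subordinated {μ : ProbabilityMeasure ℝ} (hμ : μ ∈ ID)
    (τ : ProbabilityMeasure ℝ) : ProbabilityMeasure ℝ :=
  ⟨(τ : Measure ℝ).bind (powKernel hμ), inferInstance⟩

theorem charFun_subordinated {μ : ProbabilityMeasure ℝ} (hμ : μ ∈ ID) {φ : ℝ → ℂ}
    (hφ : IsCharExponent μ φ) (τ : ProbabilityMeasure ℝ) (z : ℝ) :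
    charFun (subordinated hμ τ : Measure ℝ) z = laplace (τ : Measure ℝ) (φ z) := by
  have : IsProbabilityMeasure ((τ : Measure ℝ).bind (powKernel hμ)) := inferInstance
  rw [charFun_eq_integral_exp_I, laplace]
  simp only [subordinated, ProbabilityMeasure.coe_mk]
  rw [integral_bind_kernel (integrable_exp_I _ z)]
  refine integral_congr_ae (Eventually.of_forall fun s => ?_)
  simp only
  rw [← charFun_eq_integral_exp_I, charFun_powKernel hμ hφ]

/-- An `n`-th root is obtained by subordinating to an `n`-th root of the time law, as the Laplace
transform turns convolution powers into powers. -/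
theorem subordinated_mem_ID {μ τ : ProbabilityMeasure ℝ} (hμ : μ ∈ ID) (hτ : τ ∈ IDPos) :
    subordinated hμ τ ∈ ID := by
  obtain ⟨φ, hφ⟩ := exists_isCharExponent hμ
  intro n hn
  obtain ⟨η, hη⟩ := hτ.1 n hn
  have hη0 := root_Iio_zero hn hη hτ.2
  refine ⟨subordinated hμ η, Measure.ext_of_charFun (funext fun z => ?_)⟩
  rw [charFun_convPow, charFun_subordinated hμ hφ, charFun_subordinated hμ hφ,
    ← laplace_convPow hη0 (hφ.re_nonpos z), hη]

end Mixture

/-! ### Small-time estimates for the semigroup -/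

section Bounds

theorem integrable_one_sub_sinc (η : Measure ℝ) [IsFiniteMeasure η] :
    Integrable (fun x => 1 - Real.sinc x) η := (integrable_const _).sub Real.integrable_sinc

theorem integrable_tau (η : Measure ℝ) [IsFiniteMeasure η] : Integrable tau η :=
  Integrable.of_bound measurable_tau.aestronglyMeasurable 1 (Eventually.of_forall abs_tau_le)

theorem truncMean_eq_integral_tau (μ : ProbabilityMeasure ℝ) (s : ℝ) :
    truncMean μ s = ∫ x, tau x ∂(convRPow μ s : Measure ℝ) := by
  have hms : MeasurableSet {x : ℝ | |x| ≤ 1} := measurableSet_le (by fun_prop) (by fun_prop)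
  rw [truncMean, ← integral_indicator hms]
  congr 1

/-- Small-time estimates for the convolution semigroup. -/
theorem exists_convRPow_bounds {μ : ProbabilityMeasure ℝ} (hμ : μ ∈ ID) :
    ∃ C : ℝ, 0 ≤ C ∧ ∀ s : ℝ, 0 ≤ s →
      ∫ x, (1 - Real.sinc x) ∂(convRPow μ s : Measure ℝ) ≤ C * min 1 s ∧
      |truncMean μ s| ≤ C * min 1 s := by
  obtain ⟨φ, hφ⟩ := exists_isCharExponent hμ
  obtain ⟨B, hB⟩ := (isCompact_Icc (a := (-1 : ℝ)) (b := 1)).exists_bound_of_continuousOn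
    hφ.1.continuousOn
  have hB0 : 0 ≤ B := (norm_nonneg _).trans (hB 0 (by simp))
  have key : ∀ s : ℝ, 0 ≤ s → ∀ t : ℝ, |t| ≤ 1 →
      ‖1 - charFun (convRPow μ s : Measure ℝ) t‖ ≤ (B + 2) * min 1 s := by
    intro s hs t ht
    rw [charFun_convRPow hμ hφ hs, norm_sub_rev]
    refine (norm_exp_mul_sub_one_le (hφ.re_nonpos t) hs).trans ?_
    have := hB t (abs_le.mp ht)
    gcongr
  -- `41 = 40 + 1`: the cost of replacing `τ` by `sin`, plus the bound for the mean of `sin`.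
  refine ⟨41 * (B + 2), by positivity, fun s hs => ?_⟩
  have h1 := integral_one_sub_sinc_le (key s hs)
  have hm : 0 ≤ (B + 2) * min 1 s := by positivity
  refine ⟨by linarith, ?_⟩
  have hsin : Integrable (fun x : ℝ => Real.sin x) (convRPow μ s : Measure ℝ) :=
    Integrable.of_bound (by fun_prop) 1 (Eventually.of_forall fun x => Real.abs_sin_le_one x)
  have h2 : |∫ x, Real.sin x ∂(convRPow μ s : Measure ℝ)| ≤ (B + 2) * min 1 s := by
    have h3 := im_charFun (convRPow μ s : Measure ℝ) 1
    simp only [one_mul] at h3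
    rw [← h3]
    have h4 := (Complex.abs_im_le_norm (1 - charFun (convRPow μ s : Measure ℝ) 1)).trans
      (key s hs 1 (by simp))
    simpa using h4
  have h5 : |∫ x, (tau x - Real.sin x) ∂(convRPow μ s : Measure ℝ)|
      ≤ 40 * ∫ x, (1 - Real.sinc x) ∂(convRPow μ s : Measure ℝ) := by
    rw [← integral_const_mul]
    refine (abs_integral_le_integral_abs).trans ?_
    exact integral_mono ((integrable_tau _).sub hsin).abs
      ((integrable_one_sub_sinc _).const_mul 40) abs_tau_sub_sin_le
  rw [integral_sub (integrable_tau _) hsin] at h5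
  rw [truncMean_eq_integral_tau]
  rw [abs_le] at h2 h5 ⊢
  constructor <;> linarith [h2.1, h2.2, h5.1, h5.2]

end Bounds

/-! ### The exponent of the prescribed triplet -/

section Triplet

variable {μ : ProbabilityMeasure ℝ} {ρ : Measure ℝ}

theorem levyMix_eq (hμ : μ ∈ ID) (ρ : Measure ℝ) :
    levyMix μ ρ = ((ρ.restrict (Set.Ioi 0)).bind (powKernel hμ)).restrict {0}ᶜ := by
  rw [levyMix]
  congr 1
  refine Measure.bind_congr_right ?_
  filter_upwards [ae_restrict_mem measurableSet_Ioi] with s hs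
  rw [powKernel_apply, max_eq_left (le_of_lt hs)]

theorem integrable_min_one_restrict (hρ : ∫⁻ x, ENNReal.ofReal (min 1 |x|) ∂ρ < ∞) :
    Integrable (fun s : ℝ => min 1 |s|) (ρ.restrict (Set.Ioi 0)) := by
  have : Integrable (fun s : ℝ => min 1 |s|) ρ :=
    integrable_of_norm_le_mul (g := fun x => min 1 |x|) (by fun_prop) (fun x => by positivity) hρ
      (Measurable.aestronglyMeasurable (by fun_prop)) (C := 1)
      (fun x => by rw [Real.norm_of_nonneg (by positivity), one_mul])
  exact this.restrict

theorem integrableOn_truncMean (hμ : μ ∈ ID)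
    (hρ : ∫⁻ x, ENNReal.ofReal (min 1 |x|) ∂ρ < ∞) :
    IntegrableOn (truncMean μ) (Set.Ioi 0) ρ := by
  obtain ⟨C, hC0, hC⟩ := exists_convRPow_bounds hμ
  have hm : AEStronglyMeasurable (truncMean μ) (ρ.restrict (Set.Ioi 0)) := by
    have h : StronglyMeasurable fun s => ∫ x, tau x ∂(powKernel hμ s) :=
      measurable_tau.stronglyMeasurable.integral_kernel
    refine h.aestronglyMeasurable.congr ?_
    filter_upwards [ae_restrict_mem measurableSet_Ioi] with s hs
    rw [powKernel_apply, max_eq_left (le_of_lt hs), truncMean_eq_integral_tau]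
  refine ((integrable_min_one_restrict hρ).const_mul C).mono' hm ?_
  filter_upwards [ae_restrict_mem measurableSet_Ioi] with s hs
  have hs : 0 < s := hs
  rw [abs_of_pos hs]
  exact (hC s hs.le).2

theorem lintegral_bind_powKernel_lt_top (hμ : μ ∈ ID)
    (hρ : ∫⁻ x, ENNReal.ofReal (min 1 |x|) ∂ρ < ∞) :
    ∫⁻ x, ENNReal.ofReal (min 1 (x ^ 2)) ∂((ρ.restrict (Set.Ioi 0)).bind (powKernel hμ)) < ∞ := by
  obtain ⟨C, hC0, hC⟩ := exists_convRPow_bounds hμ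
  rw [Measure.lintegral_bind (powKernel hμ).aemeasurable
    (Measurable.aemeasurable (by fun_prop))]
  refine lt_of_le_of_lt (setLIntegral_mono
    (g := fun s => ENNReal.ofReal (40 * C) * ENNReal.ofReal (min 1 |s|)) (by fun_prop)
    fun s hs => ?_) ?_
  · have hs : 0 < s := hs
    rw [powKernel_apply, max_eq_left hs.le, ← ENNReal.ofReal_mul (by positivity), abs_of_pos hs]
    have h1 := (hC s hs.le).1
    have hi := (integrable_one_sub_sinc (convRPow μ s : Measure ℝ)).const_mul 40
    calc ∫⁻ x, ENNReal.ofReal (min 1 (x ^ 2)) ∂(convRPow μ s : Measure ℝ)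
        ≤ ∫⁻ x, ENNReal.ofReal (40 * (1 - Real.sinc x)) ∂(convRPow μ s : Measure ℝ) :=
          lintegral_mono fun x => ENNReal.ofReal_le_ofReal (min_one_sq_le x)
      _ = ENNReal.ofReal (40 * ∫ x, (1 - Real.sinc x) ∂(convRPow μ s : Measure ℝ)) := by
          rw [← ofReal_integral_eq_lintegral_ofReal hi
            (Eventually.of_forall fun x => mul_nonneg (by norm_num) (one_sub_sinc_nonneg x)),
            integral_const_mul]
      _ ≤ _ := ENNReal.ofReal_le_ofReal (by linarith)
  · rw [lintegral_const_mul _ (by fun_prop)]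
    exact ENNReal.mul_lt_top ENNReal.ofReal_lt_top
      (lt_of_le_of_lt (setLIntegral_le_lintegral _ _) hρ)

theorem isLevyMeasure_levyMix (hμ : μ ∈ ID)
    (hρ : ∫⁻ x, ENNReal.ofReal (min 1 |x|) ∂ρ < ∞) : IsLevyMeasure (levyMix μ ρ) := by
  refine ⟨?_, ?_⟩
  · rw [levyMix, Measure.restrict_apply (measurableSet_singleton 0)]; simp
  · rw [levyMix_eq hμ]
    exact lt_of_le_of_lt (setLIntegral_le_lintegral _ _) (lintegral_bind_powKernel_lt_top hμ hρ)

theorem IsLevyMeasure.add_smul {ν ν' : Measure ℝ} (hν : IsLevyMeasure ν) (hν' : IsLevyMeasure ν')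
    (β : ℝ) : IsLevyMeasure (ENNReal.ofReal β • ν + ν') := by
  refine ⟨by simp [hν.1, hν'.1], ?_⟩
  rw [lintegral_add_measure, lintegral_smul_measure]
  exact ENNReal.add_lt_top.mpr ⟨ENNReal.mul_lt_top ENNReal.ofReal_lt_top hν.2, hν'.2⟩

theorem integrableOn_exp_mul_sub_one (hρ : ∫⁻ x, ENNReal.ofReal (min 1 |x|) ∂ρ < ∞) {w : ℂ}
    (hw : w.re ≤ 0) :
    IntegrableOn (fun s : ℝ => Complex.exp (s * w) - 1) (Set.Ioi 0) ρ := by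
  refine ((integrable_min_one_restrict hρ).const_mul (‖w‖ + 2)).mono'
    (by fun_prop) ?_
  filter_upwards [ae_restrict_mem measurableSet_Ioi] with s hs
  have hs : 0 < s := hs
  rw [abs_of_pos hs]
  exact norm_exp_mul_sub_one_le hw hs.le

/-- The integrand vanishes at 0, so discarding the atom of the mixture there changes nothing. Under
`μ^s` the exponential integrates to `e^{sφ}` and the compensator to the truncated mean. -/
theorem integral_levyMix (hμ : μ ∈ ID) {φ : ℝ → ℂ} (hφ : IsCharExponent μ φ)
    (hρ : ∫⁻ x, ENNReal.ofReal (min 1 |x|) ∂ρ < ∞) (z : ℝ) :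
    ∫ x : ℝ, (Complex.exp (Complex.I * z * x) - 1 - Complex.I * (tau x) * z) ∂(levyMix μ ρ)
      = (∫ s in Set.Ioi (0 : ℝ), (Complex.exp (s * φ z) - 1) ∂ρ)
        - Complex.I * z * ((∫ s in Set.Ioi (0 : ℝ), truncMean μ s ∂ρ : ℝ) : ℂ) := by
  have hmeas : Measurable fun x : ℝ =>
      Complex.exp (Complex.I * z * x) - 1 - Complex.I * (tau x) * z := by
    have := measurable_tau; fun_prop
  have hint : Integrable (fun x : ℝ =>
      Complex.exp (Complex.I * z * x) - 1 - Complex.I * (tau x) * z)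
      ((ρ.restrict (Set.Ioi 0)).bind (powKernel hμ)) :=
    integrable_of_norm_le_mul (by fun_prop) (fun x => by positivity)
      (lintegral_bind_powKernel_lt_top hμ hρ) hmeas.aestronglyMeasurable
      (norm_levyIntegrand_tau_le z)
  rw [levyMix_eq hμ, setIntegral_eq_integral_of_forall_compl_eq_zero (fun x hx => by
    have hx : x = 0 := by simpa using hx
    simp [hx, tau]), integral_bind_kernel hint, ← integral_complex_ofReal, ← integral_const_mul,
    ← integral_sub (integrableOn_exp_mul_sub_one hρ (hφ.re_nonpos z))
      ((integrableOn_truncMean hμ hρ).complexOfReal.const_mul _)]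
  refine setIntegral_congr_fun measurableSet_Ioi fun s hs => ?_
  have hs : 0 < s := hs
  have e : ∀ x : ℝ, Complex.exp (Complex.I * z * x) - 1 - Complex.I * (tau x) * z
      = (Complex.exp (Complex.I * z * x) - 1) - Complex.I * z * (tau x : ℂ) := fun x => by ring
  have hi : Integrable (fun x : ℝ => Complex.exp (Complex.I * z * x) - 1) (powKernel hμ s) :=
    (integrable_exp_I _ z).sub (integrable_const _)
  simp_rw [e]
  rw [integral_sub hi
    ((integrable_tau _).complexOfReal.const_mul _), integral_sub (integrable_exp_I _ z)
    (integrable_const _), ← charFun_eq_integral_exp_I, charFun_powKernel hμ hφ,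
    integral_const_mul, integral_complex_ofReal, powKernel_apply, max_eq_left hs.le,
    truncMean_eq_integral_tau]
  simp

/-- The extra drift `∫ truncMean dρ` exactly cancels the compensator of the mixed Lévy measure. -/
theorem levyExponent_subordinated (hμ : μ ∈ ID) {γ b : ℝ} {ν : Measure ℝ}
    (h : HasTriplet μ γ b ν) {β : ℝ} (hβ : 0 ≤ β)
    (hρ : ∫⁻ x, ENNReal.ofReal (min 1 |x|) ∂ρ < ∞) (z : ℝ) :
    levyExponent tau (γ * β + ∫ s in Set.Ioi 0, truncMean μ s ∂ρ) (b * β)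
      (ENNReal.ofReal β • ν + levyMix μ ρ) z
      = β * levyExponent tau γ b ν z
        + ∫ s in Set.Ioi (0 : ℝ), (Complex.exp (s * levyExponent tau γ b ν z) - 1) ∂ρ := by
  have hmix := integral_levyMix hμ (isCharExponent_levyExponent h) hρ z
  have hi1 := h.2.1.integrable_levyIntegrand z
  have hi2 := (isLevyMeasure_levyMix hμ hρ).integrable_levyIntegrand z
  rw [levyExponent, integral_add_measure (hi1.smul_measure ENNReal.ofReal_ne_top) hi2, hmix,
    integral_smul_measure, ENNReal.toReal_ofReal hβ, Complex.real_smul]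
  set J := ∫ s in Set.Ioi (0 : ℝ), (Complex.exp (s * levyExponent tau γ b ν z) - 1) ∂ρ
  rw [levyExponent]
  push_cast
  ring

end Triplet

/-! ### Identification of `Λ` with subordination -/

section WellDefined

theorem isLambda_subordinated {μL μT : ProbabilityMeasure ℝ} (hL : μL ∈ ID) (hT : μT ∈ IDPos) :
    IsLambda μL μT (subordinated hL μT) := by
  obtain ⟨γ, b, ν, htrip⟩ := exists_hasTriplet hL
  obtain ⟨β, ρ, hβ, hpair, hlap⟩ := exists_hasPair hT
  have hφ := isCharExponent_levyExponent htrip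
  refine ⟨γ, b, ν, β, ρ, htrip, hpair, hβ, integrableOn_truncMean hL hpair.2.1,
    mul_nonneg htrip.1 hβ, htrip.2.1.add_smul (isLevyMeasure_levyMix hL hpair.2.1) β,
    fun z => ?_⟩
  rw [charFun_subordinated hL hφ, hlap _ (hφ.re_nonpos z),
    levyExponent_subordinated hL htrip hβ hpair.2.1]

theorem eq_subordinated_of_isLambda {μL μT μ : ProbabilityMeasure ℝ} (hL : μL ∈ ID)
    (hT : μT ∈ IDPos) (h : IsLambda μL μT μ) : μ = subordinated hL μT := by
  obtain ⟨γ, b, ν, β, ρ, htrip, hpair, hβ, -, hbar⟩ := h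
  obtain ⟨β', ρ', -, hpair', hlap⟩ := exists_hasPair hT
  -- The given pair is the constructed one, so the Laplace formula at `φ z`, off the imaginary axis
  -- in general, applies to it.
  obtain ⟨rfl, rfl⟩ := hpair.unique hpair'
  have hφ := isCharExponent_levyExponent htrip
  have heq : (μ : Measure ℝ) = (subordinated hL μT : Measure ℝ) := by
    refine Measure.ext_of_charFun (funext fun z => ?_)
    rw [hbar.2.2, levyExponent_subordinated hL htrip hβ hpair.2.1, charFun_subordinated hL hφ,
      hlap _ (hφ.re_nonpos z)]
  exact Subtype.ext heq

theorem isLambda_Lambda {μL μT : ProbabilityMeasure ℝ} (hL : μL ∈ ID) (hT : μT ∈ IDPos) :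
    IsLambda μL μT (Lambda μL μT) :=
  Classical.epsilon_spec ⟨_, isLambda_subordinated hL hT⟩

theorem Lambda_eq_subordinated {μL μT : ProbabilityMeasure ℝ} (hL : μL ∈ ID) (hT : μT ∈ IDPos) :
    Lambda μL μT = subordinated hL μT :=
  eq_subordinated_of_isLambda hL hT (isLambda_Lambda hL hT)

end WellDefined

/-! ### Continuity of the two sections -/

section Continuity

theorem continuous_subordinated {μ : ProbabilityMeasure ℝ} (hμ : μ ∈ ID) :
    Continuous (subordinated hμ) := by
  rw [continuous_iff_continuousAt]
  intro τ
  refine (ProbabilityMeasure.tendsto_iff_forall_integral_tendsto).mpr fun f => ?_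
  have hint : ∀ τ : ProbabilityMeasure ℝ, ∫ x, f x ∂(subordinated hμ τ : Measure ℝ)
      = ∫ s, ∫ x, f x ∂(convRPow μ (max s 0) : Measure ℝ) ∂(τ : Measure ℝ) := by
    intro τ
    have : IsProbabilityMeasure ((τ : Measure ℝ).bind (powKernel hμ)) := inferInstance
    simp only [subordinated, ProbabilityMeasure.coe_mk]
    rw [integral_bind_kernel (f.integrable _)]
    rfl
  have hF : Continuous fun s : ℝ => ∫ x, f x ∂(convRPow μ (max s 0) : Measure ℝ) := by
    rw [continuous_iff_continuousAt]
    intro s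
    exact ProbabilityMeasure.tendsto_iff_forall_integral_tendsto.mp
      ((continuous_convRPow_max hμ).tendsto s) f
  have hb : ∀ s : ℝ, ‖∫ x, f x ∂(convRPow μ (max s 0) : Measure ℝ)‖ ≤ ‖f‖ :=
    fun s => f.norm_integral_le_norm _
  simp_rw [hint]
  exact ProbabilityMeasure.tendsto_iff_forall_integral_tendsto.mp (tendsto_id (x := 𝓝 τ))
    (BoundedContinuousFunction.ofNormedAddCommGroup _ hF ‖f‖ hb)

/-- The value at `(μ, t)` is the integral of the fixed bounded continuous function `e^{ixy}` against
`μ ⊗ δ_t`, which depends continuously on `(μ, t)`. -/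
theorem continuous_charFun_uncurry :
    Continuous fun p : ProbabilityMeasure ℝ × ℝ => charFun (p.1 : Measure ℝ) p.2 := by
  have h1 : Continuous fun p : ProbabilityMeasure ℝ × ℝ =>
      ProbabilityMeasure.prod p.1 (diracProba p.2) :=
    ProbabilityMeasure.continuous_prod.comp
      (continuous_fst.prodMk (continuous_diracProba.comp continuous_snd))
  let g : BoundedContinuousFunction (ℝ × ℝ) ℂ :=
    BoundedContinuousFunction.ofNormedAddCommGroup
      (fun q : ℝ × ℝ => Complex.exp ((q.2 * q.1 : ℝ) * Complex.I)) (by fun_prop) 1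
      (fun q => by rw [Complex.norm_exp_ofReal_mul_I])
  rw [continuous_iff_continuousAt]
  intro p
  have h2 := (ProbabilityMeasure.tendsto_iff_forall_integral_rclike_tendsto ℂ).mp (h1.tendsto p) g
  have e : ∀ p : ProbabilityMeasure ℝ × ℝ,
      ∫ q, g q ∂(ProbabilityMeasure.prod p.1 (diracProba p.2) : Measure (ℝ × ℝ))
        = charFun (p.1 : Measure ℝ) p.2 := by
    intro p
    rw [ProbabilityMeasure.toMeasure_prod, integral_prod _ (g.integrable _), charFun_apply_real]
    refine integral_congr_ae (Eventually.of_forall fun x => ?_)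
    simp only [diracProba, ProbabilityMeasure.coe_mk]
    rw [integral_dirac]
    simp [g]
  simp_rw [e] at h2
  exact h2

/-- Characteristic exponents converge pointwise under weak convergence. -/
theorem tendsto_charExponent {μ : ℕ → ProbabilityMeasure ℝ} {μ₀ : ProbabilityMeasure ℝ}
    {φ : ℕ → ℝ → ℂ} {φ₀ : ℝ → ℂ} (hφ : ∀ n, IsCharExponent (μ n) (φ n))
    (hφ₀ : IsCharExponent μ₀ φ₀) (hlim : Tendsto μ atTop (𝓝 μ₀)) (z : ℝ) :
    Tendsto (fun n => φ n z) atTop (𝓝 (φ₀ z)) := by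
  have hr : ∀ n t, Complex.exp (φ n t - φ₀ t)
      = charFun (μ n : Measure ℝ) t * Complex.exp (-φ₀ t) := fun n t => by
    rw [sub_eq_add_neg, Complex.exp_add, ← (hφ n).2.2]
  have hloc : TendstoLocallyUniformly (fun n t => Complex.exp (φ n t - φ₀ t)) (fun _ => 1)
      atTop := by
    rw [tendstoLocallyUniformly_iff_forall_tendsto]
    intro t
    have h1 : Tendsto (fun y : ℕ × ℝ => charFun (μ y.1 : Measure ℝ) y.2 * Complex.exp (-φ₀ y.2))
        (atTop ×ˢ 𝓝 t) (𝓝 (charFun (μ₀ : Measure ℝ) t * Complex.exp (-φ₀ t))) := by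
      refine Tendsto.mul ?_ ?_
      · exact (continuous_charFun_uncurry.tendsto (μ₀, t)).comp
          (by
            rw [nhds_prod_eq]
            exact (hlim.comp tendsto_fst).prodMk tendsto_snd)
      · have hc : Continuous fun t => Complex.exp (-φ₀ t) := by have := hφ₀.1; fun_prop
        exact (hc.tendsto t).comp tendsto_snd
    rw [hφ₀.2.2, ← Complex.exp_add, add_neg_cancel, Complex.exp_zero] at h1
    rw [tendsto_uniformity_iff_dist_tendsto_zero]
    simp_rw [hr]
    have := (tendsto_const_nhds (x := (1 : ℂ))).dist h1
    rwa [dist_self] at this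
  have hunif : TendstoUniformlyOn (fun n t => Complex.exp (φ n t - φ₀ t)) (fun _ => 1) atTop
      (Set.uIcc 0 z) :=
    (tendstoLocallyUniformlyOn_iff_tendstoUniformlyOn_of_compact isCompact_uIcc).mp
      hloc.tendstoLocallyUniformlyOn
  -- Once the exponentials are within 1 of 1 on the whole segment from 0 to `z`, the principal
  -- logarithm is continuous along it. It then agrees with `φ n - φ₀`, both being 0 at the origin.
  have hev : ∀ᶠ n in atTop, φ n z - φ₀ z = Complex.log (Complex.exp (φ n z - φ₀ z)) := by
    filter_upwards [Metric.tendstoUniformlyOn_iff.mp hunif 1 one_pos] with n hn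
    have hslit : ∀ t ∈ Set.uIcc 0 z, Complex.exp (φ n t - φ₀ t) ∈ Complex.slitPlane := by
      intro t ht
      have h := Complex.mem_slitPlane_of_norm_lt_one (z := Complex.exp (φ n t - φ₀ t) - 1)
        (by rw [← dist_eq_norm, dist_comm]; exact hn t ht)
      rwa [add_sub_cancel] at h
    have hc : Continuous fun t => φ n t - φ₀ t := (hφ n).1.sub hφ₀.1
    refine sub_eq_zero.mp (eq_zero_of_exp_eq_one (S := Set.uIcc 0 z) (x₀ := 0)
      (g := fun t => φ n t - φ₀ t - Complex.log (Complex.exp (φ n t - φ₀ t)))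
      isPreconnected_uIcc ?_ (fun t _ => ?_) Set.left_mem_uIcc ?_ Set.right_mem_uIcc)
    · exact hc.continuousOn.sub (ContinuousOn.clog hc.cexp.continuousOn hslit)
    · rw [Complex.exp_sub, Complex.exp_log (Complex.exp_ne_zero _),
        div_self (Complex.exp_ne_zero _)]
    · simp [(hφ n).2.1, hφ₀.2.1]
  have h1 : Tendsto (fun n => Complex.exp (φ n z - φ₀ z)) atTop (𝓝 1) :=
    hunif.tendsto_at Set.right_mem_uIcc
  have h2 := (continuousAt_clog Complex.one_mem_slitPlane).tendsto.comp h1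
  rw [Complex.log_one] at h2
  have h3 : Tendsto (fun n => φ n z - φ₀ z) atTop (𝓝 0) :=
    h2.congr' (hev.mono fun n hn => hn.symm)
  exact tendsto_sub_nhds_zero_iff.mp h3

theorem continuous_LambdaL {μL : ProbabilityMeasure ℝ} (hL : μL ∈ ID) :
    Continuous (LambdaL μL) := by
  have e : LambdaL μL = fun μT : IDPos => subordinated hL μT :=
    funext fun μT => Lambda_eq_subordinated hL μT.2
  rw [e]
  exact (continuous_subordinated hL).comp continuous_subtype_val

theorem continuous_LambdaT {μT : ProbabilityMeasure ℝ} (hT : μT ∈ IDPos) :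
    Continuous (LambdaT μT) := by
  rw [continuous_iff_seqContinuous]
  intro u μ₀ hu
  have e : ∀ μL : ID, LambdaT μT μL = subordinated μL.2 μT := fun μL =>
    Lambda_eq_subordinated μL.2 hT
  choose φ hφ using fun n => exists_isCharExponent (u n).2
  obtain ⟨φ₀, hφ₀⟩ := exists_isCharExponent μ₀.2
  refine ProbabilityMeasure.tendsto_of_tendsto_charFun fun z => ?_
  simp only [Function.comp, e]
  simp_rw [fun n => charFun_subordinated (u n).2 (hφ n) μT z]
  rw [charFun_subordinated μ₀.2 hφ₀]
  have hlim := tendsto_charExponent hφ hφ₀ ((continuous_subtype_val.tendsto μ₀).comp hu) z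
  -- The bound 1 holds for every `n` because all exponents lie in the closed left half-plane.
  refine tendsto_integral_of_dominated_convergence (fun _ => 1)
    (fun n => Measurable.aestronglyMeasurable (by fun_prop)) (integrable_const _)
    (fun n => Eventually.of_forall (norm_exp_max_mul_le ((hφ n).re_nonpos z)))
    (Eventually.of_forall fun x => ?_)
  exact (Complex.continuous_exp.tendsto _).comp (hlim.const_mul _)

end Continuity

end LevySubordination

theorem mainTheorem11 :
    -- `Λ` is well defined on `ID(ℝ) × ID(ℝ⁺)`, with values in `ID(ℝ)`
    (∀ μL ∈ LevySubordination.ID, ∀ μT ∈ LevySubordination.IDPos,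
      (∃! μbar : ProbabilityMeasure ℝ, LevySubordination.IsLambda μL μT μbar) ∧
        LevySubordination.IsLambda μL μT (LevySubordination.Lambda μL μT) ∧
        LevySubordination.Lambda μL μT ∈ LevySubordination.ID) ∧
    -- its sections are continuous for weak convergence
    (∀ μL ∈ LevySubordination.ID, Continuous (LevySubordination.LambdaL μL)) ∧
    (∀ μT ∈ LevySubordination.IDPos, Continuous (LevySubordination.LambdaT μT)) := by
  exact ⟨fun _ hL _ hT => ⟨⟨_, LevySubordination.isLambda_subordinated hL hT, fun _ h =>
      LevySubordination.eq_subordinated_of_isLambda hL hT h⟩,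
    LevySubordination.isLambda_Lambda hL hT, by
      rw [LevySubordination.Lambda_eq_subordinated hL hT]
      exact LevySubordination.subordinated_mem_ID hL hT⟩,
    fun _ hL => LevySubordination.continuous_LambdaL hL,
    fun _ hT => LevySubordination.continuous_LambdaT hT⟩
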